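/- Let $n\geq 1$ be an integer and let $x_1,\dots,x_n,y,z$ be the coordinates of $\mathbb{C}^{n+2}$. For a polynomial $p\in\mathbb{C}[x_1,\dots,x_n,y,z]$ let $V(p)\subset\mathbb{C}^{n+2}$ denote its zero set. For $k\in\mathbb{N}$ write $\underline{x}^{[k]}=x_1^k\cdots x_n^k$, for $q\in\mathbb{C}[t]$ put $$P_q=\underline{x}^{[2]}y+z^2+\underline{x}^{[1]}q(z^2)\in\mathbb{C}[x_1,\dots,x_n,y,z],$$ and for $i,j\in\{0,1\}$ put $$V_{i,j}=V\bigl(\underline{x}^{[2]}y+z^2+i\,\underline{x}^{[1]}-j\bigr)\subset\mathbb{C}^{n+2}.$$ Two algebraic subsets of affine spaces over $\mathbb{C}$ are isomorphic (as algebraic varieties) if there are mutually inverse maps between them that are restrictions of polynomial maps. Then for every $q\in\mathbb{C}[t]$ and every $c\in\mathbb{C}$, the variety $V(P_q-c)$ is isomorphic to: 1. $V_{0,0}$ if and only if $c=0$ and $q(c)=0$; 2. $V_{1,0}$ if and only if $c=0$ and $q(c)\neq0$; 3. $V_{0,1}$ if and only if $c\neq0$ and $q(c)=0$; 4. $V_{1,1}$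 if and only if $c\neq0$ and $q(c)\neq0$. In particular, $V(P_q-c)$ is isomorphic to exactly one of $V_{0,0},V_{1,0},V_{0,1},V_{1,1}$, and these four hypersurfaces are pairwise non-isomorphic. -/

import Mathlib

open MvPolynomial

/-- The index set of the coordinates `x_1, …, x_n, y, z` of `ℂ^{n+2}`. -/
abbrev Coord (n : ℕ) : Type := Fin n ⊕ Fin 2

/-- The polynomial ring `ℂ[x_1, …, x_n, y, z]`. -/
abbrev CoordPoly (n : ℕ) : Type := MvPolynomial (Coord n) ℂ

namespace CoordPoly

/-- `x^{[k]} = x_1^k ⋯ x_n^k`. -/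
noncomputable def xProd (n k : ℕ) : CoordPoly n := ∏ i : Fin n, X (Sum.inl i) ^ k

/-- The variable `y`. -/
noncomputable def y (n : ℕ) : CoordPoly n := X (Sum.inr 0)

/-- The variable `z`. -/
noncomputable def z (n : ℕ) : CoordPoly n := X (Sum.inr 1)

/-- `P_q = x^{[2]} y + z^2 + x^{[1]} q(z^2)`. -/
noncomputable def P (n : ℕ) (q : Polynomial ℂ) : CoordPoly n :=
  xProd n 2 * y n + z n ^ 2 + xProd n 1 * Polynomial.aeval (z n ^ 2) q

end CoordPoly

/-- The hypersurface `V(p) = {v | p(v) = 0}` in affine space `ℂ^σ`. -/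
def hypersurface {σ : Type*} (p : MvPolynomial σ ℂ) : Set (σ → ℂ) :=
  zeroLocus ℂ (Ideal.span {p})

theorem mem_hypersurface_iff {σ : Type*} (p : MvPolynomial σ ℂ) (v : σ → ℂ) :
    v ∈ hypersurface p ↔ eval v p = 0 := by
  simp [hypersurface, zeroLocus_span, MvPolynomial.aeval_eq_eval]

/-- The polynomial map `ℂ^σ → ℂ^τ` with components `F`. -/
noncomputable def polyMap {σ τ : Type*} (F : τ → MvPolynomial σ ℂ) (v : σ → ℂ) : τ → ℂ :=
  fun t => eval v (F t)

/-- Two algebraic subsets of affine spaces over `ℂ` are isomorphic as (affine) algebraic varieties: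
there are polynomial maps between them that are inverse to each other. -/
def IsomorphicVarieties {σ τ : Type*} (V : Set (σ → ℂ)) (W : Set (τ → ℂ)) : Prop :=
  ∃ (F : τ → MvPolynomial σ ℂ) (G : σ → MvPolynomial τ ℂ),
    Set.MapsTo (polyMap F) V W ∧ Set.MapsTo (polyMap G) W V ∧
      Set.InvOn (polyMap G) (polyMap F) V W

/-- The four hypersurfaces `V_{i,j} : x^{[2]} y + z^2 + i x^{[1]} - j = 0`, `i, j ∈ {0, 1}`. -/
noncomputable def modelHypersurface (n : ℕ) (i j : Fin 2) : Set (Coord n → ℂ) :=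
  hypersurface (CoordPoly.xProd n 2 * CoordPoly.y n + CoordPoly.z n ^ 2 +
    C ((i : ℕ) : ℂ) * CoordPoly.xProd n 1 - C ((j : ℕ) : ℂ))

/-- The fibre `V(P_q - c)`. -/
noncomputable def fibre (n : ℕ) (q : Polynomial ℂ) (c : ℂ) : Set (Coord n → ℂ) :=
  hypersurface (CoordPoly.P n q - C c)

/-!
Write `A = ℂ[x_1, …, x_n]` and `x = x_1 ⋯ x_n`, and consider more generally the hypersurfaces
`x² y + z² + β x - γ = 0` with parameters `β, γ ∈ ℂ`.

**Existence of isomorphisms.** On the fibre over `c`, the function `z² - c` is a multiple of `x`.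
Hence the part `(z² - c) r(z²)` of `q(z²)` contributes a multiple of `x²` to the equation, and a
change of the coordinate `y` removes it: the fibre is isomorphic to the hypersurface with parameters
`β = q(c)`, `γ = c` (`fibre_isomorphic_quadricHypersurface`). Rescaling `x_1`, `y`, `z` makes the
nonzero parameters equal to `1` (`quadricHypersurface_isomorphic_model`).

**Invariance of the vanishing of the parameters.** The coordinate ring is
`A[y] ⊕ A[y] z` with `z² = γ - β x - x² y`; an isomorphism of hypersurfaces induces one of
coordinate rings (`QuadricRing.nonempty_algEquiv_of_isomorphic`). The main point is that such an
isomorphism respects `A` and `A + A z`. These are the kernels of `δ` and `δ²` for the locally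
nilpotent derivation `δ = x² ∂/∂z - 2 z ∂/∂y`, so it is enough that *every* nonzero locally
nilpotent derivation `D` satisfies `ker D ⊆ A` and `ker D² ⊆ A + A z`
(`QuadricRing.mem_of_deriv_eq_zero`).

To see this, embed the ring in the Laurent polynomials in `x_1, …, x_n, z`, ordered
lexicographically with `z` first. The basis monomials `x^a y^k z^ε`, `ε ≤ 1`, have the distinct
leading exponents `(a - 2k, 2k + ε)`, which form a semigroup `S`. The leading part of `D` multiplies
the monomial with exponent `m` by `v(m)`, for an additive function `v`, and shifts it by a fixed
vector `e`. Local nilpotency forces, after scaling, `v(e) = -1` and `m + v(m) e ∈ S` for all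
`m ∈ S`. Since the exponent of `z` at an element of `S` on the facet `m_i + k = 0` of its cone is
even, elementary combinatorics leaves only the possibility that `v` is the exponent of `z`
(`forall_weight_eq_zero`). Then an element killed by `D` has degree zero in `z`, and one killed by
`D²` has degree at most one.

An isomorphism of the coordinate rings therefore maps `z` to `a z + b` with `a ∈ ℂ` nonzero and
`b ∈ A`, and `x` to some `u ∈ A`. Comparing the two equations gives `u² ∣ x²`, by symmetry
`u = μ x` for a constant `μ`, and then `x² ∣ (a² γ' - γ) + (β μ - a² β') x`, so that `γ = a² γ'` and
`β μ = a² β'` (`QuadricRing.eq_zero_iff_of_algEquiv`).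
-/

/-! ### Isomorphisms of algebraic sets -/

namespace IsomorphicVarieties

variable {σ τ υ : Type*} {U : Set (σ → ℂ)} {V : Set (τ → ℂ)} {W : Set (υ → ℂ)}

theorem symm (h : IsomorphicVarieties U V) : IsomorphicVarieties V U := by
  obtain ⟨F, G, hF, hG, hFG⟩ := h
  exact ⟨G, F, hG, hF, hFG.symm⟩

theorem _root_.polyMap_bind₁ (F : τ → MvPolynomial σ ℂ) (G : υ → MvPolynomial τ ℂ) :
    polyMap (fun t => bind₁ F (G t)) = polyMap G ∘ polyMap F := by
  funext v t
  simp only [polyMap, Function.comp_apply, ← aeval_eq_eval, aeval_bind₁]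
  rfl

theorem trans (h₁ : IsomorphicVarieties U V) (h₂ : IsomorphicVarieties V W) :
    IsomorphicVarieties U W := by
  obtain ⟨F, G, hF, hG, hFG⟩ := h₁
  obtain ⟨F', G', hF', hG', hFG'⟩ := h₂
  refine ⟨fun t => bind₁ F (F' t), fun t => bind₁ G' (G t), ?_, ?_, ?_, ?_⟩
  · rw [polyMap_bind₁]; exact hF'.comp hF
  · rw [polyMap_bind₁]; exact hG.comp hG'
  · rw [polyMap_bind₁, polyMap_bind₁]
    intro v hv
    simp only [Function.comp_apply]
    rw [hFG'.1 (hF hv), hFG.1 hv]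
  · rw [polyMap_bind₁, polyMap_bind₁]
    intro v hv
    simp only [Function.comp_apply]
    rw [hFG.2 (hG' hv), hFG'.2 hv]

end IsomorphicVarieties

/-! ### Reduction to the model hypersurfaces -/

/-- The hypersurface `x^{[2]} y + z^2 + β x^{[1]} - γ = 0`; the models `V_{i,j}` are the cases
`β, γ ∈ {0, 1}`. -/
noncomputable def quadricHypersurface (n : ℕ) (β γ : ℂ) : Set (Coord n → ℂ) :=
  hypersurface (CoordPoly.xProd n 2 * CoordPoly.y n + CoordPoly.z n ^ 2 +
    C β * CoordPoly.xProd n 1 - C γ)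

theorem modelHypersurface_eq (n : ℕ) (i j : Fin 2) :
    modelHypersurface n i j = quadricHypersurface n ((i : ℕ) : ℂ) ((j : ℕ) : ℂ) := rfl

theorem mem_quadricHypersurface_iff {n : ℕ} {β γ : ℂ} {v : Coord n → ℂ} :
    v ∈ quadricHypersurface n β γ ↔
      (∏ i, v (Sum.inl i)) ^ 2 * v (Sum.inr 0) + v (Sum.inr 1) ^ 2 +
        β * ∏ i, v (Sum.inl i) - γ = 0 := by
  simp [quadricHypersurface, mem_hypersurface_iff, CoordPoly.xProd, CoordPoly.y, CoordPoly.z,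
    map_prod, Finset.prod_pow]

theorem mem_fibre_iff {n : ℕ} {q : Polynomial ℂ} {c : ℂ} {v : Coord n → ℂ} :
    v ∈ fibre n q c ↔
      (∏ i, v (Sum.inl i)) ^ 2 * v (Sum.inr 0) + v (Sum.inr 1) ^ 2 +
        (∏ i, v (Sum.inl i)) * q.eval (v (Sum.inr 1) ^ 2) - c = 0 := by
  have : ∀ p : CoordPoly n, eval v (Polynomial.aeval p q) = q.eval (eval v p) := by
    intro p
    rw [← aeval_eq_eval, ← Polynomial.aeval_algHom_apply, Polynomial.coe_aeval_eq_eval]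
  simp [fibre, mem_hypersurface_iff, CoordPoly.P, CoordPoly.xProd, CoordPoly.y, CoordPoly.z,
    map_prod, Finset.prod_pow, this]

/-- Only the value `q(c)` matters: on the fibre `z^2 - c` is divisible by `x^{[1]}`, so the part
`(z^2 - c) r(z^2)` of `q(z^2)` contributes a multiple of `x^{[2]}`, which a polynomial change of
the coordinate `y` absorbs. -/
theorem fibre_isomorphic_quadricHypersurface (n : ℕ) (q : Polynomial ℂ) (c : ℂ) :
    IsomorphicVarieties (fibre n q c) (quadricHypersurface n (q.eval c) c) := by
  obtain ⟨r, hr⟩ := Polynomial.X_sub_C_dvd_sub_C_eval (a := c) (p := q)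
  have hr' : ∀ t, q.eval t = q.eval c + (t - c) * r.eval t := by
    intro t
    have := congrArg (Polynomial.eval t) hr
    simp only [Polynomial.eval_sub, Polynomial.eval_mul, Polynomial.eval_X,
      Polynomial.eval_C] at this
    linear_combination this
  have hev : ∀ (v : Coord n → ℂ) (f : Polynomial ℂ),
      eval v (Polynomial.aeval (CoordPoly.z n ^ 2) f) = f.eval (v (Sum.inr 1) ^ 2) := by
    intro v f
    rw [← aeval_eq_eval, ← Polynomial.aeval_algHom_apply, Polynomial.coe_aeval_eq_eval]
    simp [CoordPoly.z]
  let F : Coord n → CoordPoly n := Sum.elim (fun i => X (Sum.inl i))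
    ![CoordPoly.y n * (1 - CoordPoly.xProd n 1 * Polynomial.aeval (CoordPoly.z n ^ 2) r) -
      Polynomial.aeval (CoordPoly.z n ^ 2) r * Polynomial.aeval (CoordPoly.z n ^ 2) q,
      CoordPoly.z n]
  let G : Coord n → CoordPoly n := Sum.elim (fun i => X (Sum.inl i))
    ![CoordPoly.y n + (C (q.eval c) + CoordPoly.xProd n 1 * CoordPoly.y n) *
      Polynomial.aeval (CoordPoly.z n ^ 2) r, CoordPoly.z n]
  have hFx : ∀ v i, polyMap F v (Sum.inl i) = v (Sum.inl i) := by simp [polyMap, F]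
  have hGx : ∀ v i, polyMap G v (Sum.inl i) = v (Sum.inl i) := by simp [polyMap, G]
  have hFz : ∀ v, polyMap F v (Sum.inr 1) = v (Sum.inr 1) := by simp [polyMap, F, CoordPoly.z]
  have hGz : ∀ v, polyMap G v (Sum.inr 1) = v (Sum.inr 1) := by simp [polyMap, G, CoordPoly.z]
  have hFy : ∀ v, polyMap F v (Sum.inr 0) = v (Sum.inr 0) *
      (1 - (∏ i, v (Sum.inl i)) * r.eval (v (Sum.inr 1) ^ 2)) -
      r.eval (v (Sum.inr 1) ^ 2) * q.eval (v (Sum.inr 1) ^ 2) := by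
    intro v; simp [polyMap, F, hev]; simp [CoordPoly.y, CoordPoly.xProd]
  have hGy : ∀ v, polyMap G v (Sum.inr 0) = v (Sum.inr 0) +
      (q.eval c + (∏ i, v (Sum.inl i)) * v (Sum.inr 0)) * r.eval (v (Sum.inr 1) ^ 2) := by
    intro v; simp [polyMap, G, hev]; simp [CoordPoly.y, CoordPoly.xProd]
  refine ⟨F, G, ?_, ?_, ?_, ?_⟩
  · intro v hv
    rw [mem_fibre_iff] at hv
    rw [mem_quadricHypersurface_iff, hFy, hFz]
    simp only [hFx]
    generalize ∏ i, v (Sum.inl i) = x at *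
    generalize v (Sum.inr 0) = y at *
    generalize v (Sum.inr 1) = z at *
    rw [hr' (z ^ 2)] at hv ⊢
    linear_combination (1 - r.eval (z ^ 2) * x) * hv
  · intro v hv
    rw [mem_quadricHypersurface_iff] at hv
    rw [mem_fibre_iff, hGy, hGz]
    simp only [hGx]
    generalize ∏ i, v (Sum.inl i) = x at *
    generalize v (Sum.inr 0) = y at *
    generalize v (Sum.inr 1) = z at *
    rw [hr' (z ^ 2)]
    linear_combination (1 + x * r.eval (z ^ 2)) * hv
  · intro v hv
    rw [mem_fibre_iff] at hv
    funext t
    rcases t with i | t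
    · rw [hGx, hFx]
    · fin_cases t
      · simp only [Fin.zero_eta, hGy, hFx, hFz, hFy]
        generalize ∏ i, v (Sum.inl i) = x at *
        generalize v (Sum.inr 0) = y at *
        generalize v (Sum.inr 1) = z at *
        rw [hr' (z ^ 2)] at hv ⊢
        linear_combination (- r.eval (z ^ 2) ^ 2) * hv
      · simp only [Fin.mk_one, hGz, hFz]
  · intro v hv
    rw [mem_quadricHypersurface_iff] at hv
    funext t
    rcases t with i | t
    · rw [hFx, hGx]
    · fin_cases t
      · simp only [Fin.zero_eta, hGy, hGx, hGz, hFy]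
        generalize ∏ i, v (Sum.inl i) = x at *
        generalize v (Sum.inr 0) = y at *
        generalize v (Sum.inr 1) = z at *
        rw [hr' (z ^ 2)]
        linear_combination (- r.eval (z ^ 2) ^ 2) * hv
      · simp only [Fin.mk_one, hFz, hGz]

/-- Rescaling `x_1`, `y` and `z` normalizes the nonzero parameters to `1`. -/
theorem quadricHypersurface_isomorphic_model {n : ℕ} (hn : 1 ≤ n) {β γ : ℂ} {i j : Fin 2}
    (hi : i = 0 ↔ β = 0) (hj : j = 0 ↔ γ = 0) :
    IsomorphicVarieties (quadricHypersurface n β γ) (modelHypersurface n i j) := by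
  rw [modelHypersurface_eq]
  obtain ⟨ω, hω, hωj⟩ : ∃ ω : ℂ, ω ≠ 0 ∧ γ = ω ^ 2 * ((j : ℕ) : ℂ) := by
    by_cases h : γ = 0
    · exact ⟨1, one_ne_zero, by simp [hj.2 h, h]⟩
    · obtain ⟨ω, hω⟩ := IsAlgClosed.exists_pow_nat_eq γ (n := 2) (by norm_num)
      have : j = 1 := Fin.eq_one_of_ne_zero j (mt hj.1 h)
      refine ⟨ω, ?_, by simp [this, hω]⟩
      rintro rfl
      exact h (by simp [← hω])
  obtain ⟨τ, hτ, hτi⟩ : ∃ τ : ℂ, τ ≠ 0 ∧ τ * β = ω ^ 2 * ((i : ℕ) : ℂ) := by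
    by_cases h : β = 0
    · exact ⟨1, one_ne_zero, by simp [hi.2 h, h]⟩
    · have : i = 1 := Fin.eq_one_of_ne_zero i (mt hi.1 h)
      exact ⟨ω ^ 2 / β, by positivity, by simp [this, h]⟩
  have hscale : ∀ (k : ℂ) (v : Coord n → ℂ),
      ∏ l, (if l = (⟨0, hn⟩ : Fin n) then k else 1) * v (Sum.inl l) =
        k * ∏ l, v (Sum.inl l) := by
    intro k v
    rw [Finset.prod_mul_distrib, Finset.prod_ite_eq' Finset.univ]
    simp
  let T (a b d : ℂ) : Coord n → CoordPoly n := Sum.elim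
    (fun l => C (if l = (⟨0, hn⟩ : Fin n) then a else 1) * X (Sum.inl l))
    ![C b * X (Sum.inr 0), C d * X (Sum.inr 1)]
  have hTx : ∀ a b d v l, polyMap (T a b d) v (Sum.inl l) =
      (if l = (⟨0, hn⟩ : Fin n) then a else 1) * v (Sum.inl l) := by
    intros; simp [polyMap, T]
  have hTy : ∀ a b d v, polyMap (T a b d) v (Sum.inr 0) = b * v (Sum.inr 0) := by
    intros; simp [polyMap, T]
  have hTz : ∀ a b d v, polyMap (T a b d) v (Sum.inr 1) = d * v (Sum.inr 1) := by
    intros; simp [polyMap, T]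
  have hTT : ∀ a b d a' b' d' : ℂ, a * a' = 1 → b * b' = 1 → d * d' = 1 → ∀ v,
      polyMap (T a b d) (polyMap (T a' b' d') v) = v := by
    intro a b d a' b' d' ha hb hd v
    funext t
    rcases t with l | t
    · rw [hTx, hTx]
      split_ifs
      · linear_combination v (Sum.inl l) * ha
      · ring
    · fin_cases t
      · simp only [Fin.zero_eta, hTy]
        linear_combination v (Sum.inr 0) * hb
      · simp only [Fin.mk_one, hTz]
        linear_combination v (Sum.inr 1) * hd
  refine ⟨T τ⁻¹ (ω ^ 2 / τ ^ 2)⁻¹ ω⁻¹, T τ (ω ^ 2 / τ ^ 2) ω, ?_, ?_, ?_, ?_⟩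
  · intro v hv
    rw [mem_quadricHypersurface_iff] at hv ⊢
    simp only [hTx, hTy, hTz, hscale]
    generalize ∏ i, v (Sum.inl i) = x at *
    generalize v (Sum.inr 0) = y at *
    generalize v (Sum.inr 1) = z at *
    have e : ((i : ℕ) : ℂ) = τ * β / ω ^ 2 := by field_simp; linear_combination -hτi
    rw [e]
    rw [hωj] at hv
    field_simp
    linear_combination hv
  · intro v hv
    rw [mem_quadricHypersurface_iff] at hv ⊢
    simp only [hTx, hTy, hTz, hscale]
    generalize ∏ i, v (Sum.inl i) = x at *
    generalize v (Sum.inr 0) = y at *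
    generalize v (Sum.inr 1) = z at *
    have : (τ * x) ^ 2 * (ω ^ 2 / τ ^ 2 * y) = ω ^ 2 * (x ^ 2 * y) := by field_simp
    rw [this, hωj]
    linear_combination ω ^ 2 * hv + x * hτi
  · intro v _
    apply hTT <;> field_simp
  · intro v _
    apply hTT <;> field_simp

/-! ### The coordinate ring of a model -/

/-- The product `x_1 ⋯ x_n` in `ℂ[x_1, …, x_n]`. -/
noncomputable def xMon (n : ℕ) : MvPolynomial (Fin n) ℂ := ∏ i, X i

/-- The element `γ - β x^{[1]} - x^{[2]} y` of `ℂ[x_1, …, x_n][y]`, which is `z^2` on the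
hypersurface with parameters `β, γ`. -/
noncomputable def zSq (n : ℕ) (β γ : ℂ) : Polynomial (MvPolynomial (Fin n) ℂ) :=
  Polynomial.C (C γ - C β * xMon n) - Polynomial.C (xMon n ^ 2) * Polynomial.X

/-- The coordinate ring of `quadricHypersurface n β γ`. Its equation is monic quadratic in `z`, so
the ring is `A[y] ⊕ A[y] z` with `A = ℂ[x_1, …, x_n]`. -/
abbrev QuadricRing (n : ℕ) (β γ : ℂ) : Type :=
  QuadraticAlgebra (Polynomial (MvPolynomial (Fin n) ℂ)) (zSq n β γ) 0

namespace QuadricRing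

variable {n : ℕ} {β γ : ℂ}

/-- The inclusion of `A = ℂ[x_1, …, x_n]` in the coordinate ring. -/
noncomputable def base (n : ℕ) (β γ : ℂ) : MvPolynomial (Fin n) ℂ →ₐ[ℂ] QuadricRing n β γ where
  toFun a := ⟨Polynomial.C a, 0⟩
  map_one' := by ext1 <;> simp [QuadraticAlgebra.re_one, QuadraticAlgebra.im_one]
  map_mul' a b := by ext1 <;> simp
  map_zero' := by ext1 <;> simp
  map_add' a b := by ext1 <;> simp
  commutes' _ := rfl

theorem re_mul (a b : QuadricRing n β γ) :
    (a * b).re = a.re * b.re + zSq n β γ * a.im * b.im := QuadraticAlgebra.re_mul a b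

theorem im_mul (a b : QuadricRing n β γ) :
    (a * b).im = a.re * b.im + a.im * b.re := by
  rw [QuadraticAlgebra.im_mul]; ring

@[simp] theorem base_re (a : MvPolynomial (Fin n) ℂ) : (base n β γ a).re = Polynomial.C a := rfl
@[simp] theorem base_im (a : MvPolynomial (Fin n) ℂ) : (base n β γ a).im = 0 := rfl

theorem base_injective : Function.Injective (base n β γ) := fun a b h => by
  simpa using congrArg QuadraticAlgebra.re h

/-- The coordinate functions `x_1, …, x_n, y, z`. -/
noncomputable def coord (n : ℕ) (β γ : ℂ) : Coord n → QuadricRing n β γ :=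
  Sum.elim (fun i => base n β γ (X i)) ![⟨Polynomial.X, 0⟩, ⟨0, 1⟩]

theorem coord_x (i : Fin n) : coord n β γ (Sum.inl i) = base n β γ (X i) := rfl
theorem coord_y : coord n β γ (Sum.inr 0) = ⟨Polynomial.X, 0⟩ := rfl
theorem coord_z : coord n β γ (Sum.inr 1) = ⟨0, 1⟩ := rfl

/-- The defining equation. -/
theorem coord_z_mul_self : coord n β γ (Sum.inr 1) * coord n β γ (Sum.inr 1) =
    algebraMap ℂ _ γ - algebraMap ℂ _ β * base n β γ (xMon n) -
      base n β γ (xMon n) ^ 2 * coord n β γ (Sum.inr 0) := by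
  have hc : ∀ c : ℂ, algebraMap ℂ (QuadricRing n β γ) c = base n β γ (C c) := fun _ => rfl
  rw [hc, hc, ← map_mul, ← map_sub, ← map_pow]
  ext1
  · rw [QuadraticAlgebra.re_sub, re_mul, re_mul, coord_y, coord_z]
    simp only [base_re, base_im, zSq]
    ring
  · rw [QuadraticAlgebra.im_sub, im_mul, im_mul, coord_y, coord_z]
    simp only [base_im]
    ring

section Lift

variable {S : Type*} [CommRing S] [Algebra ℂ S]

/-- The homomorphism from `A[y]` given by the images of the variables. -/
noncomputable def liftBase (s : Coord n → S) : Polynomial (MvPolynomial (Fin n) ℂ) →+* S :=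
  Polynomial.eval₂RingHom (aeval fun i => s (Sum.inl i) : _ →ₐ[ℂ] S).toRingHom (s (Sum.inr 0))

/-- The universal property of the coordinate ring. -/
noncomputable def lift (s : Coord n → S)
    (h : s (Sum.inr 1) * s (Sum.inr 1) = algebraMap ℂ S γ - algebraMap ℂ S β *
      (∏ i, s (Sum.inl i)) - (∏ i, s (Sum.inl i)) ^ 2 * s (Sum.inr 0)) :
    QuadricRing n β γ →ₐ[ℂ] S :=
  have hz : liftBase s (zSq n β γ) = s (Sum.inr 1) * s (Sum.inr 1) := by
    rw [h]
    simp only [liftBase, zSq, xMon, AlgHom.toRingHom_eq_coe, map_sub, map_mul, map_pow, map_prod,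
      Polynomial.coe_eval₂RingHom, Polynomial.eval₂_C, Polynomial.eval₂_X, RingHom.coe_coe,
      algHom_C, aeval_X]
  { toFun r := liftBase s r.re + liftBase s r.im * s (Sum.inr 1)
    map_one' := by simp [QuadraticAlgebra.re_one, QuadraticAlgebra.im_one]
    map_mul' a b := by
      simp only [QuadraticAlgebra.re_mul, QuadraticAlgebra.im_mul, map_add, map_mul, hz, map_zero]
      ring
    map_zero' := by simp
    map_add' a b := by simp only [QuadraticAlgebra.re_add, QuadraticAlgebra.im_add, map_add]; ring
    commutes' c := by
      have : algebraMap ℂ (QuadricRing n β γ) c = base n β γ (C c) := rfl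
      rw [this, base_re, base_im]
      simp [liftBase] }

theorem lift_apply (s : Coord n → S) (h) (r : QuadricRing n β γ) :
    lift (β := β) (γ := γ) s h r = liftBase s r.re + liftBase s r.im * s (Sum.inr 1) := rfl

@[simp] theorem lift_base (s : Coord n → S) (h) (a : MvPolynomial (Fin n) ℂ) :
    lift (β := β) (γ := γ) s h (base n β γ a) = aeval (fun i => s (Sum.inl i)) a := by
  simp [lift_apply, liftBase]

@[simp] theorem lift_coord (s : Coord n → S) (h) (t : Coord n) :
    lift (β := β) (γ := γ) s h (coord n β γ t) = s t := by
  rcases t with i | t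
  · rw [coord_x, lift_base, aeval_X]
  · fin_cases t
    · simp [lift_apply, coord_y, liftBase]
    · simp [lift_apply, coord_z, liftBase]

end Lift

/-- Restriction of polynomials on `ℂ^{n+2}` to the hypersurface. -/
noncomputable def restrict (n : ℕ) (β γ : ℂ) : CoordPoly n →ₐ[ℂ] QuadricRing n β γ :=
  aeval (coord n β γ)

theorem aeval_x_eq_base (a : MvPolynomial (Fin n) ℂ) :
    aeval (fun i => coord n β γ (Sum.inl i)) a = base n β γ a := by
  have : (aeval fun i => coord n β γ (Sum.inl i)) = base n β γ := by
    refine MvPolynomial.algHom_ext fun i => ?_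
    rw [aeval_X, coord_x]
  rw [this]

theorem restrict_surjective : Function.Surjective (restrict n β γ) := by
  have key : ∀ p : Polynomial (MvPolynomial (Fin n) ℂ),
      (⟨p, 0⟩ : QuadricRing n β γ) ∈ (restrict n β γ).range := by
    intro p
    induction p using Polynomial.induction_on' with
    | add p q hp hq =>
      have : (⟨p + q, 0⟩ : QuadricRing n β γ) = ⟨p, 0⟩ + ⟨q, 0⟩ := by ext1 <;> simp
      rw [this]; exact add_mem hp hq
    | monomial k a =>
      have : (⟨Polynomial.monomial k a, 0⟩ : QuadricRing n β γ) =
          restrict n β γ (rename Sum.inl a * X (Sum.inr 0) ^ k) := by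
        rw [map_mul, map_pow, restrict, aeval_rename, aeval_X]
        change _ = aeval (fun i => coord n β γ (Sum.inl i)) a * _
        have hy : (coord n β γ (Sum.inr 0)) ^ k = ⟨Polynomial.X ^ k, 0⟩ :=
          (QuadraticAlgebra.C_pow k Polynomial.X).symm
        rw [aeval_x_eq_base, hy]
        ext1
        · simp [Polynomial.C_mul_X_pow_eq_monomial]
        · simp
      rw [this]; exact ⟨_, rfl⟩
  intro r
  have : r = ⟨r.re, 0⟩ + ⟨r.im, 0⟩ * restrict n β γ (X (Sum.inr 1)) := by
    rw [restrict, aeval_X, coord_z]; ext1 <;> simp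
  have h2 : r ∈ (restrict n β γ).range := by
    rw [this]; exact add_mem (key _) (mul_mem (key _) ⟨_, rfl⟩)
  exact h2

/-- Evaluation of elements of the coordinate ring at a point of the hypersurface. -/
noncomputable def evalAt (v : Coord n → ℂ) (hv : v ∈ quadricHypersurface n β γ) :
    QuadricRing n β γ →ₐ[ℂ] ℂ :=
  lift v (by
    rw [mem_quadricHypersurface_iff] at hv
    simp only [Algebra.algebraMap_self, RingHom.id_apply]
    linear_combination hv)

theorem evalAt_restrict (v : Coord n → ℂ) (hv : v ∈ quadricHypersurface n β γ) (p : CoordPoly n) :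
    evalAt v hv (restrict n β γ p) = eval v p := by
  have : (evalAt v hv).comp (restrict n β γ) = aeval v := by
    ext t; simp [evalAt, restrict]
  rw [← aeval_eq_eval, ← this]; rfl

theorem zSq_ne_zero : zSq n β γ ≠ 0 := by
  intro h
  have := congrArg (fun p => Polynomial.coeff p 1) h
  simp [zSq, Polynomial.coeff_C, xMon, Finset.prod_eq_zero_iff, -map_mul, -map_pow,
    -map_sub] at this

theorem eq_zero_of_eval_eq_zero {p : Polynomial (MvPolynomial (Fin n) ℂ)}
    (h : ∀ (x : Fin n → ℂ) (y : ℂ), (p.map (eval x)).eval y = 0) : p = 0 := by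
  ext1 k
  refine MvPolynomial.funext fun x => ?_
  have : p.map (eval x) = 0 := Polynomial.funext fun y => by simp [h]
  simpa using congrArg (fun q => Polynomial.coeff q k) this

/-- An element of the coordinate ring that vanishes at every point is zero: over `(x, y)` lie the
points with `z` either square root of `z^2`. -/
theorem eq_zero_of_evalAt {r : QuadricRing n β γ} (h : ∀ v hv, evalAt v hv r = 0) : r = 0 := by
  have hlift : ∀ (v : Coord n → ℂ) (p : Polynomial (MvPolynomial (Fin n) ℂ)),
      liftBase v p = (p.map (eval fun i => v (Sum.inl i))).eval (v (Sum.inr 0)) := by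
    intro v p
    simp only [liftBase, Polynomial.coe_eval₂RingHom, Polynomial.eval_map]
    rfl
  have key : ∀ (x : Fin n → ℂ) (y : ℂ), (r.re.map (eval x)).eval y = 0 ∧
      ((zSq n β γ * r.im ^ 2).map (eval x)).eval y = 0 := by
    intro x y
    obtain ⟨w, hw⟩ := IsAlgClosed.exists_pow_nat_eq (((zSq n β γ).map (eval x)).eval y)
      (n := 2) (by norm_num)
    have hmem : ∀ e : ℂ, e ^ 2 = 1 →
        (Sum.elim x ![y, e * w] : Coord n → ℂ) ∈ quadricHypersurface n β γ := by
      intro e he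
      rw [mem_quadricHypersurface_iff]
      simp only [zSq, xMon, map_prod, map_sub, map_mul, map_pow, Polynomial.map_sub,
        Polynomial.map_mul, Polynomial.map_pow, Polynomial.map_prod, Polynomial.map_C,
        Polynomial.map_X, Polynomial.eval_sub, Polynomial.eval_mul, Polynomial.eval_pow,
        Polynomial.eval_prod, Polynomial.eval_C, Polynomial.eval_X, eval_C, eval_X] at hw
      simp only [Sum.elim_inl, Sum.elim_inr, Matrix.cons_val_zero, Matrix.cons_val_one]
      linear_combination w ^ 2 * he + hw
    have h1 := h _ (hmem 1 (by norm_num))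
    have h2 := h _ (hmem (-1) (by norm_num))
    rw [evalAt, lift_apply, hlift, hlift] at h1 h2
    simp at h1 h2
    refine ⟨by linear_combination (h1 + h2) / 2, ?_⟩
    simp only [Polynomial.map_mul, Polynomial.map_pow, Polynomial.eval_mul, Polynomial.eval_pow,
      ← hw]
    have h3 : Polynomial.eval y (Polynomial.map (eval x) r.im) * w = 0 := by
      linear_combination (h1 - h2) / 2
    linear_combination (Polynomial.eval y (Polynomial.map (eval x) r.im) * w) * h3
  have hre := eq_zero_of_eval_eq_zero fun x y => (key x y).1
  have him := eq_zero_of_eval_eq_zero fun x y => (key x y).2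
  have him' : r.im = 0 := by
    simpa [zSq_ne_zero] using him
  ext1 <;> simp [hre, him']

theorem restrict_eq_zero_iff {p : CoordPoly n} :
    restrict n β γ p = 0 ↔ ∀ v ∈ quadricHypersurface n β γ, eval v p = 0 := by
  constructor
  · intro h v hv
    rw [← evalAt_restrict v hv, h, map_zero]
  · intro h
    exact eq_zero_of_evalAt fun v hv => by rw [evalAt_restrict, h v hv]

/-- Pull-back of functions along a polynomial map between two of the hypersurfaces. -/
theorem exists_pullback {β' γ' : ℂ} (F : Coord n → CoordPoly n)
    (hF : Set.MapsTo (polyMap F) (quadricHypersurface n β γ) (quadricHypersurface n β' γ')) :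
    ∃ φ : QuadricRing n β' γ' →ₐ[ℂ] QuadricRing n β γ,
      ∀ p, φ (restrict n β' γ' p) = restrict n β γ (aeval F p) := by
  have hrel := (restrict_eq_zero_iff (n := n) (β := β) (γ := γ)
    (p := aeval F (X (Sum.inr 1) * X (Sum.inr 1) - (C γ' - C β' * (∏ i, X (Sum.inl i)) -
      (∏ i, X (Sum.inl i)) ^ 2 * X (Sum.inr 0)) : CoordPoly n))).2 (by
    intro v hv
    have := hF hv
    rw [mem_quadricHypersurface_iff] at this
    simp only [polyMap] at this
    simp only [map_sub, map_mul, map_pow, map_prod, aeval_X, algHom_C, algebraMap_eq, eval_C]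
    linear_combination this)
  let φ : QuadricRing n β' γ' →ₐ[ℂ] QuadricRing n β γ := lift (fun t => restrict n β γ (F t)) (by
    simp only [map_sub, map_mul, map_pow, map_prod, aeval_X, algHom_C, AlgHom.commutes] at hrel
    linear_combination hrel)
  refine ⟨φ, fun p => ?_⟩
  have : φ.comp (restrict n β' γ') = (restrict n β γ).comp (aeval F) := by
    refine MvPolynomial.algHom_ext fun t => ?_
    rw [AlgHom.comp_apply, AlgHom.comp_apply, restrict, aeval_X, lift_coord, aeval_X]
  exact DFunLike.congr_fun this p

/-- Isomorphic hypersurfaces have isomorphic coordinate rings. -/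
theorem nonempty_algEquiv_of_isomorphic {β' γ' : ℂ}
    (h : IsomorphicVarieties (quadricHypersurface n β γ) (quadricHypersurface n β' γ')) :
    Nonempty (QuadricRing n β γ ≃ₐ[ℂ] QuadricRing n β' γ') := by
  obtain ⟨F, G, hF, hG, hFG⟩ := h
  obtain ⟨φ, hφ⟩ := exists_pullback F hF
  obtain ⟨ψ, hψ⟩ := exists_pullback G hG
  have hcomp : ∀ (F G : Coord n → CoordPoly n) (p : CoordPoly n) (v : Coord n → ℂ),
      eval v (aeval F (aeval G p)) = eval (polyMap G (polyMap F v)) p := by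
    intro F G p v
    rw [← Function.comp_apply (f := polyMap G), ← polyMap_bind₁, ← aeval_eq_eval, ← aeval_eq_eval]
    change (aeval v) (bind₁ F (bind₁ G p)) = _
    rw [bind₁_bind₁, aeval_bind₁]
    rfl
  refine ⟨AlgEquiv.ofAlgHom ψ φ ?_ ?_⟩
  · refine AlgHom.ext fun r => ?_
    obtain ⟨p, rfl⟩ := restrict_surjective r
    rw [AlgHom.comp_apply, hφ, hψ, AlgHom.id_apply, ← sub_eq_zero, ← map_sub,
      restrict_eq_zero_iff]
    intro v hv
    rw [map_sub, hcomp, hFG.2 hv, sub_self]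
  · refine AlgHom.ext fun r => ?_
    obtain ⟨p, rfl⟩ := restrict_surjective r
    rw [AlgHom.comp_apply, hψ, hφ, AlgHom.id_apply, ← sub_eq_zero, ← map_sub,
      restrict_eq_zero_iff]
    intro v hv
    rw [map_sub, hcomp, hFG.1 hv, sub_self]

end QuadricRing

/-! ### Exponents of Laurent monomials -/

/-- Exponents of the Laurent monomials in `x_1, …, x_n, z`, ordered lexicographically. The entry
`0` is minus the exponent of `z`, so that the terms of highest degree in `z` come first. -/
abbrev LaurentExp (n : ℕ) : Type := Lex (Fin (n + 1) → ℤ)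

namespace LaurentExp

variable {n : ℕ}

/-- The exponent of `z`. -/
def zDeg (n : ℕ) : LaurentExp n →+ ℤ where
  toFun m := - ofLex m 0
  map_zero' := neg_zero
  map_add' a b := by rw [ofLex_add, Pi.add_apply, neg_add]

/-- The exponent of `x_i`. -/
def xDeg (i : Fin n) : LaurentExp n →+ ℤ where
  toFun m := ofLex m i.succ
  map_zero' := rfl
  map_add' a b := by rw [ofLex_add, Pi.add_apply]

/-- The exponent of `x^a z^k`. -/
def mk (a : Fin n → ℤ) (k : ℤ) : LaurentExp n := toLex (Fin.cons (-k) a)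

@[simp] theorem zDeg_mk (a : Fin n → ℤ) (k : ℤ) : zDeg n (mk a k) = k := by simp [zDeg, mk]

@[simp] theorem xDeg_mk (a : Fin n → ℤ) (k : ℤ) (i : Fin n) : xDeg i (mk a k) = a i := by
  simp [xDeg, mk]

theorem ext {a b : LaurentExp n} (hz : zDeg n a = zDeg n b) (hx : ∀ i, xDeg i a = xDeg i b) :
    a = b := by
  refine ofLex.injective (funext fun i => ?_)
  refine Fin.cases ?_ (fun i => ?_) i
  · simpa [zDeg] using hz
  · simpa [xDeg] using hx i

theorem lt_of_zDeg_lt {a b : LaurentExp n} (h : zDeg n b < zDeg n a) : a < b := by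
  refine ⟨0, fun j hj => absurd hj (Fin.not_lt_zero j), ?_⟩
  simpa [zDeg] using h

theorem zDeg_le_of_le {a b : LaurentExp n} (h : a ≤ b) : zDeg n b ≤ zDeg n a := by
  by_contra! hlt
  exact absurd (lt_of_zDeg_lt hlt) (not_lt.2 h)

end LaurentExp

/-! ### Leading terms of Hahn series -/

namespace HahnSeries

variable {Γ R : Type*} [AddCommGroup Γ] [LinearOrder Γ] [IsOrderedAddMonoid Γ] [CommRing R]

theorem coeff_mul_of_lt {f g : HahnSeries Γ R} {a b c : Γ} (hf : ∀ k < a, f.coeff k = 0)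
    (hg : ∀ k < b, g.coeff k = 0) (hc : c < a + b) : (f * g).coeff c = 0 := by
  rw [coeff_mul]
  refine Finset.sum_eq_zero fun ij hij => ?_
  have h := (Finset.mem_antidiagonal.1 hij).2.2
  rcases lt_or_ge ij.1 a with h1 | h1
  · rw [hf _ h1, zero_mul]
  · rcases lt_or_ge ij.2 b with h2 | h2
    · rw [hg _ h2, mul_zero]
    · exact absurd (add_le_add h1 h2) (by rw [h]; exact not_le.2 hc)

theorem coeff_mul_add {f g : HahnSeries Γ R} {a b : Γ} (hf : ∀ k < a, f.coeff k = 0)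
    (hg : ∀ k < b, g.coeff k = 0) : (f * g).coeff (a + b) = f.coeff a * g.coeff b := by
  rw [coeff_mul]
  rw [Finset.sum_eq_single (a, b)]
  · intro ij hij hne
    have h := (Finset.mem_antidiagonal.1 hij).2.2
    rcases lt_or_ge ij.1 a with h1 | h1
    · rw [hf _ h1, zero_mul]
    · rcases lt_or_ge ij.2 b with h2 | h2
      · rw [hg _ h2, mul_zero]
      · exfalso
        apply hne
        have e1 : ij.1 = a := le_antisymm (by
          by_contra! h3
          exact absurd h (ne_of_gt (add_lt_add_of_lt_of_le h3 h2))) h1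
        have e2 : ij.2 = b := by rw [e1] at h; exact add_left_cancel h
        exact Prod.ext e1 e2
  · intro h
    by_contra hne
    apply h
    rw [Finset.mem_antidiagonal]
    exact ⟨mem_support _ _ |>.2 (left_ne_zero_of_mul hne),
      mem_support _ _ |>.2 (right_ne_zero_of_mul hne), rfl⟩

end HahnSeries

/-! ### The leading part of a derivation -/

section LeadingPart

variable {Γ R : Type*} [AddCommGroup Γ] [LinearOrder Γ] [IsOrderedAddMonoid Γ]
  [CommRing R] [Algebra ℂ R]

/-- `f` has all its terms at exponents `≥ m`, the derivation `D` raises exponents of `f` by at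
least `e`, and it multiplies the term of exponent `m` by `l`, to leading order. -/
structure LeadingScalar (ι : R →ₐ[ℂ] HahnSeries Γ ℂ) (D : Derivation ℂ R R) (e : Γ)
    (f : R) (m : Γ) (l : ℂ) : Prop where
  coeff_eq_zero : ∀ k < m, (ι f).coeff k = 0
  coeff_deriv_eq_zero : ∀ k < m + e, (ι (D f)).coeff k = 0
  coeff_deriv : (ι (D f)).coeff (m + e) = l * (ι f).coeff m

namespace LeadingScalar

variable {ι : R →ₐ[ℂ] HahnSeries Γ ℂ} {D : Derivation ℂ R R} {e : Γ} {f g : R} {m k : Γ} {l l' : ℂ}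

theorem mul (hf : LeadingScalar ι D e f m l) (hg : LeadingScalar ι D e g k l') :
    LeadingScalar ι D e (f * g) (m + k) (l + l') := by
  have h1 : m + k + e = m + (k + e) := by abel
  have h2 : m + k + e = k + (m + e) := by abel
  refine ⟨fun c hc => ?_, fun c hc => ?_, ?_⟩
  · rw [map_mul]; exact HahnSeries.coeff_mul_of_lt hf.1 hg.1 hc
  · rw [Derivation.leibniz, smul_eq_mul, smul_eq_mul, map_add, map_mul, map_mul,
      HahnSeries.coeff_add, HahnSeries.coeff_mul_of_lt hf.1 hg.2 (h1 ▸ hc),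
      HahnSeries.coeff_mul_of_lt hg.1 hf.2 (h2 ▸ hc), add_zero]
  · rw [Derivation.leibniz, smul_eq_mul, smul_eq_mul, map_add, map_mul, map_mul,
      HahnSeries.coeff_add, map_mul, HahnSeries.coeff_mul_add hf.1 hg.1]
    nth_rewrite 1 [h1]
    rw [h2, HahnSeries.coeff_mul_add hf.1 hg.2, HahnSeries.coeff_mul_add hg.1 hf.2, hf.3, hg.3]
    ring

theorem add (hf : LeadingScalar ι D e f m l) (hg : LeadingScalar ι D e g m l) :
    LeadingScalar ι D e (f + g) m l := by
  refine ⟨fun c hc => ?_, fun c hc => ?_, ?_⟩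
  · rw [map_add, HahnSeries.coeff_add, hf.1 c hc, hg.1 c hc, add_zero]
  · rw [map_add, map_add, HahnSeries.coeff_add, hf.2 c hc, hg.2 c hc, add_zero]
  · rw [map_add, map_add, map_add, HahnSeries.coeff_add, HahnSeries.coeff_add, hf.3, hg.3]
    ring

theorem smul (c : ℂ) (hf : LeadingScalar ι D e f m l) : LeadingScalar ι D e (c • f) m l := by
  refine ⟨fun k hk => ?_, fun k hk => ?_, ?_⟩
  · rw [map_smul, HahnSeries.coeff_smul, hf.1 k hk, smul_zero]
  · rw [Derivation.map_smul, map_smul, HahnSeries.coeff_smul, hf.2 k hk, smul_zero]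
  · rw [Derivation.map_smul, map_smul, map_smul, HahnSeries.coeff_smul, HahnSeries.coeff_smul, hf.3]
    simp only [smul_eq_mul]; ring

/-- Below the leading exponent there are no terms, so every scalar is right there. -/
theorem of_lt (hf : LeadingScalar ι D e f m l) (h : k < m) (l' : ℂ) :
    LeadingScalar ι D e f k l' := by
  refine ⟨fun c hc => hf.1 c (hc.trans h),
    fun c hc => hf.2 c (hc.trans (add_lt_add_left h e)), ?_⟩
  rw [hf.1 k h, hf.2 _ (add_lt_add_left h e), mul_zero]

theorem one : LeadingScalar ι D e 1 0 0 := by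
  refine ⟨fun k hk => ?_, fun k hk => ?_, ?_⟩
  · rw [map_one, HahnSeries.coeff_one, if_neg hk.ne]
  · simp
  · simp

theorem zero : LeadingScalar ι D e 0 m l := by
  refine ⟨fun k hk => ?_, fun k hk => ?_, ?_⟩ <;> simp

theorem algebraMap (c : ℂ) : LeadingScalar ι D e (algebraMap ℂ R c) 0 0 := by
  rw [Algebra.algebraMap_eq_smul_one]
  exact one.smul c

theorem pow (hf : LeadingScalar ι D e f m l) (k : ℕ) :
    LeadingScalar ι D e (f ^ k) (k • m) (k * l) := by
  induction k with
  | zero => simpa using one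
  | succ k ih =>
    rw [pow_succ, succ_nsmul]
    convert! ih.mul hf using 1
    push_cast; ring

theorem prod {κ : Type*} (s : Finset κ) {f : κ → R} {m : κ → Γ} {l : κ → ℂ}
    (h : ∀ i ∈ s, LeadingScalar ι D e (f i) (m i) (l i)) :
    LeadingScalar ι D e (∏ i ∈ s, f i) (∑ i ∈ s, m i) (∑ i ∈ s, l i) := by
  classical
  induction s using Finset.induction_on with
  | empty => simpa using one
  | insert a s ha ih =>
    rw [Finset.prod_insert ha, Finset.sum_insert ha, Finset.sum_insert ha]
    exact (h a (Finset.mem_insert_self a s)).mul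
      (ih fun i hi => h i (Finset.mem_insert_of_mem hi))

theorem sum {κ : Type*} (s : Finset κ) {f : κ → R}
    (h : ∀ i ∈ s, LeadingScalar ι D e (f i) m l) :
    LeadingScalar ι D e (∑ i ∈ s, f i) m l := by
  classical
  induction s using Finset.induction_on with
  | empty => simpa using zero
  | insert a s ha ih =>
    rw [Finset.sum_insert ha]
    exact (h a (Finset.mem_insert_self a s)).add
      (ih fun i hi => h i (Finset.mem_insert_of_mem hi))

/-- The scalar is determined at an exponent that occurs. -/
theorem unique (hf : LeadingScalar ι D e f m l) (hf' : LeadingScalar ι D e f m l')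
    (h : (ι f).coeff m ≠ 0) : l = l' :=
  mul_right_cancel₀ h (hf.3.symm.trans hf'.3)

/-- A derivation that does not kill all of finitely many elements `s t` with leading exponents
`ν t` has a well-defined degree `e` on them. -/
theorem exists_of_ne_zero {T : Type*} [Finite T] {s : T → R} {ν : T → Γ}
    (hι : Function.Injective ι)
    (hs : ∀ t, ∀ k < ν t, (ι (s t)).coeff k = 0) (hs' : ∀ t, (ι (s t)).coeff (ν t) ≠ 0)
    (hD : ∃ t, D (s t) ≠ 0) :
    ∃ (e : Γ) (l : T → ℂ), (∀ t, LeadingScalar ι D e (s t) (ν t) (l t)) ∧ ∃ t, l t ≠ 0 := by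
  classical
  cases nonempty_fintype T
  have hne : (Finset.univ.filter fun t => D (s t) ≠ 0).Nonempty := by
    obtain ⟨t, ht⟩ := hD; exact ⟨t, by simp [ht]⟩
  obtain ⟨t₀, ht₀, hmin⟩ := Finset.exists_min_image _ (fun t => (ι (D (s t))).order - ν t) hne
  simp only [Finset.mem_filter, Finset.mem_univ, true_and] at ht₀ hmin
  refine ⟨(ι (D (s t₀))).order - ν t₀, fun t =>
    (ι (D (s t))).coeff (ν t + ((ι (D (s t₀))).order - ν t₀)) / (ι (s t)).coeff (ν t),
    fun t => ⟨hs t, fun k hk => ?_, ?_⟩, t₀, ?_⟩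
  · by_cases h : D (s t) = 0
    · simp [h]
    · refine HahnSeries.coeff_eq_zero_of_lt_order (hk.trans_le ?_)
      have := hmin t h
      rw [le_sub_iff_add_le, add_comm] at this
      exact this
  · rw [div_mul_cancel₀ _ (hs' t)]
  · have : ν t₀ + ((ι (D (s t₀))).order - ν t₀) = (ι (D (s t₀))).order := by abel
    simp only [this]
    refine div_ne_zero ?_ (hs' t₀)
    rwa [Ne, HahnSeries.coeff_order_eq_zero, map_eq_zero_iff ι hι]

end LeadingScalar

end LeadingPart

/-! ### The coordinate ring inside Laurent polynomials -/

/-- The Hahn series `f` starts with a nonzero term at `m`. -/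
def HahnSeries.HasLeadingExp {Γ : Type*} [LinearOrder Γ] (f : HahnSeries Γ ℂ) (m : Γ) : Prop :=
  (∀ k < m, f.coeff k = 0) ∧ f.coeff m ≠ 0

namespace HahnSeries.HasLeadingExp

section

variable {Γ : Type*} [LinearOrder Γ] {f : HahnSeries Γ ℂ} {m k : Γ}

theorem single_one (m : Γ) : (single m (1 : ℂ)).HasLeadingExp m :=
  ⟨fun _ hk => coeff_single_of_ne hk.ne, by simp⟩

theorem one [Zero Γ] : (1 : HahnSeries Γ ℂ).HasLeadingExp 0 := single_one 0

theorem unique (hf : f.HasLeadingExp m) (hf' : f.HasLeadingExp k) : m = k := by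
  rcases lt_trichotomy m k with h | h | h
  · exact absurd (hf'.1 _ h) hf.2
  · exact h
  · exact absurd (hf.1 _ h) hf'.2

end

variable {Γ : Type*} [AddCommGroup Γ] [LinearOrder Γ] [IsOrderedAddMonoid Γ]
  {f g : HahnSeries Γ ℂ} {m k : Γ}

theorem mul (hf : f.HasLeadingExp m) (hg : g.HasLeadingExp k) :
    (f * g).HasLeadingExp (m + k) :=
  ⟨fun _ hc => coeff_mul_of_lt hf.1 hg.1 hc, by
    rw [coeff_mul_add hf.1 hg.1]; exact mul_ne_zero hf.2 hg.2⟩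

theorem pow (hf : f.HasLeadingExp m) (k : ℕ) : (f ^ k).HasLeadingExp (k • m) := by
  induction k with
  | zero => simpa using one
  | succ k ih => rw [pow_succ, succ_nsmul]; exact ih.mul hf

theorem prod {κ : Type*} (s : Finset κ) {f : κ → HahnSeries Γ ℂ} {m : κ → Γ}
    (h : ∀ i ∈ s, (f i).HasLeadingExp (m i)) :
    (∏ i ∈ s, f i).HasLeadingExp (∑ i ∈ s, m i) := by
  classical
  induction s using Finset.induction_on with
  | empty => simpa using one
  | insert a s ha ih =>
    rw [Finset.prod_insert ha, Finset.sum_insert ha]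
    exact (h a (Finset.mem_insert_self a s)).mul
      (ih fun i hi => h i (Finset.mem_insert_of_mem hi))

end HahnSeries.HasLeadingExp

namespace QuadricRing

open LaurentExp

variable {n : ℕ} {β γ : ℂ}

/-- The leading exponents of the coordinate functions: `x_i` and `z` are Laurent monomials, and
`y = (γ - β x^{[1]} - z^2) / x^{[2]}` has leading term `- z^2 / x^{[2]}`. -/
noncomputable def coordExp (n : ℕ) : Coord n → LaurentExp n :=
  Sum.elim (fun i => mk (Pi.single i 1) 0) ![mk (fun _ => -2) 2, mk 0 1]

/-- The coordinate functions as Laurent polynomials. -/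
noncomputable def laurentCoord (n : ℕ) (β γ : ℂ) : Coord n → HahnSeries (LaurentExp n) ℂ :=
  Sum.elim (fun i => HahnSeries.single (mk (Pi.single i 1) 0) 1)
    ![HahnSeries.single (mk (fun _ => -2) 0) γ - HahnSeries.single (mk (fun _ => -1) 0) β -
      HahnSeries.single (mk (fun _ => -2) 2) 1, HahnSeries.single (mk 0 1) 1]

theorem mk_add_mk (a b : Fin n → ℤ) (k l : ℤ) : mk a k + mk b l = mk (a + b) (k + l) :=
  LaurentExp.ext (by simp) (by simp)

theorem mk_zero : (mk 0 0 : LaurentExp n) = 0 := LaurentExp.ext (by simp) (by simp)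

theorem prod_laurentCoord :
    ∏ i, laurentCoord n β γ (Sum.inl i) = HahnSeries.single (mk 1 0) 1 := by
  have h1 : ∀ s : Finset (Fin n), ∏ i ∈ s, laurentCoord n β γ (Sum.inl i) =
      HahnSeries.single (∑ i ∈ s, mk (Pi.single i 1) 0) 1 := by
    classical
    intro s
    induction s using Finset.induction_on with
    | empty => simp
    | insert a s ha ih =>
      rw [Finset.prod_insert ha, ih, Finset.sum_insert ha, laurentCoord, Sum.elim_inl,
        HahnSeries.single_mul_single, one_mul]
  rw [h1]
  congr 2
  refine LaurentExp.ext (by simp) fun i => ?_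
  rw [map_sum]
  simp [Pi.single_apply]

/-- The embedding of the coordinate ring in the Laurent polynomials in `x_1, …, x_n, z`. -/
noncomputable def toLaurent (n : ℕ) (β γ : ℂ) :
    QuadricRing n β γ →ₐ[ℂ] HahnSeries (LaurentExp n) ℂ :=
  lift (laurentCoord n β γ) (by
    have hC : ∀ c, algebraMap ℂ (HahnSeries (LaurentExp n) ℂ) c = HahnSeries.single (mk 0 0) c := by
      intro c; rw [mk_zero, ← HahnSeries.C_eq_algebraMap]; rfl
    have e1 : (1 : Fin n → ℤ) + 1 + (fun _ => -2) = 0 := by funext; simp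
    have e2 : (1 : Fin n → ℤ) + 1 + (fun _ => -1) = 1 := by funext; simp
    rw [prod_laurentCoord, hC, hC]
    simp only [laurentCoord, Sum.elim_inr, Matrix.cons_val_zero, Matrix.cons_val_one, mul_sub,
      pow_two, HahnSeries.single_mul_single, mk_add_mk, e1, e2, zero_add, add_zero, mul_one,
      one_mul]
    norm_num)

theorem hasLeadingExp_coord (t : Coord n) :
    (toLaurent n β γ (coord n β γ t)).HasLeadingExp (coordExp n t) := by
  rw [toLaurent, lift_coord]
  rcases t with i | t
  · exact HahnSeries.HasLeadingExp.single_one _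
  · fin_cases t
    · have hlt : ∀ a : Fin n → ℤ, ∀ k ≤ mk (fun _ => -2) 2, k ≠ mk a 0 := by
        rintro a k hk rfl
        have := zDeg_le_of_le hk
        simp at this
      simp only [laurentCoord, coordExp, Fin.zero_eta, Sum.elim_inr, Matrix.cons_val_zero]
      refine ⟨fun k hk => ?_, ?_⟩
      · simp [HahnSeries.coeff_single_of_ne hk.ne, HahnSeries.coeff_single_of_ne (hlt _ k hk.le)]
      · simp [HahnSeries.coeff_single_of_ne (hlt _ _ le_rfl)]
    · exact HahnSeries.HasLeadingExp.single_one _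

/-- The index set of the basis `x^a y^k z^ε`, `ε ≤ 1`, of the coordinate ring. -/
abbrev MonomialIdx (n : ℕ) : Type := (Fin n → ℕ) × ℕ × Fin 2

/-- The basis element `x^a y^k z^ε`. -/
noncomputable def basisMonomial (n : ℕ) (β γ : ℂ) (u : MonomialIdx n) : QuadricRing n β γ :=
  (∏ i, coord n β γ (Sum.inl i) ^ u.1 i) * coord n β γ (Sum.inr 0) ^ u.2.1 *
    coord n β γ (Sum.inr 1) ^ (u.2.2 : ℕ)

/-- The leading exponent of `x^a y^k z^ε`. -/
noncomputable def monomialExp (u : MonomialIdx n) : LaurentExp n :=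
  (∑ i, u.1 i • coordExp n (Sum.inl i)) + u.2.1 • coordExp n (Sum.inr 0) +
    (u.2.2 : ℕ) • coordExp n (Sum.inr 1)

@[simp] theorem zDeg_monomialExp (u : MonomialIdx n) :
    zDeg n (monomialExp u) = 2 * u.2.1 + (u.2.2 : ℕ) := by
  simp only [monomialExp, coordExp, map_add, map_sum, map_nsmul, Sum.elim_inl, Sum.elim_inr,
    Matrix.cons_val_zero, Matrix.cons_val_one, zDeg_mk]
  simp
  ring

@[simp] theorem xDeg_monomialExp (u : MonomialIdx n) (i : Fin n) :
    xDeg i (monomialExp u) = u.1 i - 2 * u.2.1 := by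
  simp only [monomialExp, coordExp, map_add, map_sum, map_nsmul, Sum.elim_inl, Sum.elim_inr,
    Matrix.cons_val_zero, Matrix.cons_val_one, xDeg_mk]
  simp [Pi.single_apply]
  ring

theorem monomialExp_injective : Function.Injective (monomialExp (n := n)) := by
  rintro ⟨a, k, e⟩ ⟨a', k', e'⟩ h
  have hz := congrArg (zDeg n) h
  simp only [zDeg_monomialExp] at hz
  have hk : k = k' := by omega
  have he : e = e' := by omega
  subst hk he
  have ha : a = a' := by
    funext i
    have hx := congrArg (xDeg i) h
    simp only [xDeg_monomialExp] at hx
    omega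
  rw [ha]

theorem hasLeadingExp_basisMonomial (u : MonomialIdx n) :
    (toLaurent n β γ (basisMonomial n β γ u)).HasLeadingExp (monomialExp u) := by
  simp only [basisMonomial, map_mul, map_prod, map_pow]
  exact ((HahnSeries.HasLeadingExp.prod _ fun i _ => (hasLeadingExp_coord _).pow _).mul
    ((hasLeadingExp_coord _).pow _)).mul ((hasLeadingExp_coord _).pow _)

theorem smul_eq_base_mul (c : ℂ) (f : QuadricRing n β γ) : c • f = base n β γ (C c) * f :=
  Algebra.smul_def c f

theorem span_basisMonomial : Submodule.span ℂ (Set.range (basisMonomial n β γ)) = ⊤ := by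
  have key : ∀ (e : Fin 2) (p : Polynomial (MvPolynomial (Fin n) ℂ)),
      (⟨p, 0⟩ * coord n β γ (Sum.inr 1) ^ (e : ℕ) : QuadricRing n β γ) ∈
        Submodule.span ℂ (Set.range (basisMonomial n β γ)) := by
    intro e p
    induction p using Polynomial.induction_on' with
    | add p q hp hq =>
      have : (⟨p + q, 0⟩ : QuadricRing n β γ) = ⟨p, 0⟩ + ⟨q, 0⟩ := by ext1 <;> simp
      rw [this, add_mul]; exact add_mem hp hq
    | monomial k a =>
      have hy : (coord n β γ (Sum.inr 0)) ^ k = ⟨Polynomial.X ^ k, 0⟩ :=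
        (QuadraticAlgebra.C_pow k Polynomial.X).symm
      have h1 : ∀ a, (⟨Polynomial.monomial k a, 0⟩ : QuadricRing n β γ) =
          base n β γ a * coord n β γ (Sum.inr 0) ^ k := by
        intro a
        rw [hy]
        ext1
        · simp [Polynomial.C_mul_X_pow_eq_monomial]
        · simp
      rw [h1]
      induction a using MvPolynomial.induction_on' with
      | add p q hp hq =>
        rw [map_add, add_mul, add_mul]
        exact add_mem hp hq
      | monomial a c =>
        have h2 : base n β γ (monomial a c) * coord n β γ (Sum.inr 0) ^ k *
            coord n β γ (Sum.inr 1) ^ (e : ℕ) = c • basisMonomial n β γ (a, k, e) := by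
          rw [monomial_eq, Finsupp.prod_fintype _ _ (by simp), map_mul, map_prod, basisMonomial]
          rw [smul_eq_base_mul]
          simp only [map_pow, coord_x]
          ring
        rw [h2]
        exact Submodule.smul_mem _ _ (Submodule.subset_span ⟨_, rfl⟩)
  rw [eq_top_iff]
  rintro r -
  have : r = ⟨r.re, 0⟩ * coord n β γ (Sum.inr 1) ^ ((0 : Fin 2) : ℕ) +
      ⟨r.im, 0⟩ * coord n β γ (Sum.inr 1) ^ ((1 : Fin 2) : ℕ) := by
    simp only [Fin.val_zero, Fin.val_one, pow_zero, pow_one, mul_one, coord_z]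
    ext1 <;> simp
  rw [this]
  exact add_mem (key _ _) (key _ _)

/-- A nonzero element is a combination of basis monomials, one of which has the smallest
exponent. -/
theorem exists_expansion {f : QuadricRing n β γ} (hf : f ≠ 0) :
    ∃ c : MonomialIdx n →₀ ℂ, ∑ u ∈ c.support, c u • basisMonomial n β γ u = f ∧
      ∃ u₀ ∈ c.support, ∀ u ∈ c.support, monomialExp u₀ ≤ monomialExp u := by
  have hmem : f ∈ Submodule.span ℂ (Set.range (basisMonomial n β γ)) := by
    rw [span_basisMonomial]; trivial
  obtain ⟨c, hc⟩ := (Finsupp.mem_span_range_iff_exists_finsupp).1 hmem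
  refine ⟨c, hc, Finset.exists_min_image _ _ ?_⟩
  rw [Finset.nonempty_iff_ne_empty, Ne, Finsupp.support_eq_empty]
  rintro rfl
  exact hf (by simpa using hc.symm)

theorem hasLeadingExp_of_expansion {c : MonomialIdx n →₀ ℂ} {u₀ : MonomialIdx n}
    (hu₀ : u₀ ∈ c.support) (hmin : ∀ u ∈ c.support, monomialExp u₀ ≤ monomialExp u) :
    (toLaurent n β γ (∑ u ∈ c.support, c u • basisMonomial n β γ u)).HasLeadingExp
      (monomialExp u₀) := by
  have hco : ∀ k, (toLaurent n β γ (∑ u ∈ c.support, c u • basisMonomial n β γ u)).coeff k =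
      ∑ u ∈ c.support, c u * (toLaurent n β γ (basisMonomial n β γ u)).coeff k := by
    intro k
    rw [map_sum, HahnSeries.coeff_sum]
    simp
  refine ⟨fun k hk => ?_, ?_⟩
  · rw [hco]
    refine Finset.sum_eq_zero fun u hu => ?_
    rw [(hasLeadingExp_basisMonomial u).1 k (hk.trans_le (hmin u hu)), mul_zero]
  · rw [hco, Finset.sum_eq_single u₀]
    · exact mul_ne_zero (Finsupp.mem_support_iff.1 hu₀) (hasLeadingExp_basisMonomial u₀).2
    · intro u hu hne
      have : monomialExp u₀ < monomialExp u :=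
        lt_of_le_of_ne (hmin u hu) fun h => hne (monomialExp_injective h).symm
      rw [(hasLeadingExp_basisMonomial u).1 _ this, mul_zero]
    · exact fun h => absurd hu₀ h

theorem exists_hasLeadingExp {f : QuadricRing n β γ} (hf : f ≠ 0) :
    ∃ u, (toLaurent n β γ f).HasLeadingExp (monomialExp u) := by
  obtain ⟨c, rfl, u₀, hu₀, hmin⟩ := exists_expansion hf
  exact ⟨u₀, hasLeadingExp_of_expansion hu₀ hmin⟩

theorem toLaurent_injective : Function.Injective (toLaurent n β γ) := by
  rw [injective_iff_map_eq_zero]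
  intro f hf
  by_contra hne
  obtain ⟨u, hu⟩ := exists_hasLeadingExp hne
  exact hu.2 (by simp [hf])

/-- Elements whose leading term has degree at most one in `z` lie in `A + A z`. -/
theorem exists_base_of_zDeg_le_one {f : QuadricRing n β γ} {m : LaurentExp n}
    (h : (toLaurent n β γ f).HasLeadingExp m) (hm : zDeg n m ≤ 1) :
    ∃ a b, f = base n β γ a * coord n β γ (Sum.inr 1) + base n β γ b ∧ (zDeg n m ≤ 0 → a = 0) := by
  have hf : f ≠ 0 := by rintro rfl; exact h.2 (by simp)
  obtain ⟨c, rfl, u₀, hu₀, hmin⟩ := exists_expansion hf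
  obtain rfl := h.unique (hasLeadingExp_of_expansion hu₀ hmin)
  have hsum : ∀ s ⊆ c.support, ∃ a b, ∑ u ∈ s, c u • basisMonomial n β γ u =
      base n β γ a * coord n β γ (Sum.inr 1) + base n β γ b ∧
        (zDeg n (monomialExp u₀) ≤ 0 → a = 0) := by
    classical
    intro s
    induction s using Finset.induction_on with
    | empty => exact fun _ => ⟨0, 0, by simp, fun _ => rfl⟩
    | insert u s hus ih =>
      intro hs
      obtain ⟨a, b, hab, ha⟩ := ih fun v hv => hs (Finset.mem_insert_of_mem hv)
      have hle := zDeg_le_of_le (hmin u (hs (Finset.mem_insert_self u s)))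
      obtain ⟨p, k, e⟩ := u
      rw [Finset.sum_insert hus, hab]
      simp only [zDeg_monomialExp] at hle hm ha
      have hk : k = 0 := by omega
      subst hk
      have hbm : ∀ e, c (p, 0, e) • basisMonomial n β γ (p, 0, e) =
          base n β γ (C (c (p, 0, e)) * ∏ i, X i ^ p i) *
            coord n β γ (Sum.inr 1) ^ (e : ℕ) := by
        intro e
        rw [smul_eq_base_mul]
        simp only [basisMonomial, map_mul, map_prod, map_pow, pow_zero, mul_one, coord_x,
          mul_assoc]
      rw [hbm]
      rcases Fin.exists_fin_two.1 ⟨e, rfl⟩ with rfl | rfl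
      · refine ⟨a, C (c (p, 0, 0)) * (∏ i, X i ^ p i) + b, ?_, by simpa using ha⟩
        rw [map_add (base n β γ) _ b, Fin.val_zero, pow_zero]
        ring
      · refine ⟨C (c (p, 0, 1)) * (∏ i, X i ^ p i) + a, b, ?_, ?_⟩
        · rw [map_add (base n β γ) _ a, Fin.val_one, pow_one]
          ring
        · intro h0
          simp at hle h0
          omega
  exact hsum _ subset_rfl

end QuadricRing

/-! ### Locally nilpotent derivations of the coordinate ring -/

/-- The combinatorial core. Let `S` be the semigroup of exponents `(m, k)` of `x^m z^k` with
`0 ≤ k` and `0 ≤ m_i + 2 ⌊k / 2⌋`, and let the additive function `v (m, k) = ∑ a_i m_i + b k` take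
the value `-1` at `(E, d)`. If `v ≥ 0` on `S` and every `s ∈ S` can be moved inside `S` to
`s + v(s) (E, d)`, then `v` does not involve the exponents of the `x_i`. -/
theorem forall_weight_eq_zero {n : ℕ} (E : Fin n → ℤ) (d : ℤ) (a : Fin n → ℕ) (b : ℕ)
    (hE : ∑ i, (a i : ℤ) * E i + b * d = -1)
    (H : ∀ (m : Fin n → ℤ) (k v : ℤ), 0 ≤ k → (∀ i, 0 ≤ m i + 2 * (k / 2)) →
      v = ∑ i, (a i : ℤ) * m i + b * k →
      0 ≤ v ∧ 0 ≤ k + v * d ∧ ∀ i, 0 ≤ m i + v * E i + 2 * ((k + v * d) / 2)) :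
    ∀ i, a i = 0 := by
  by_contra! hne
  obtain ⟨i₀, hi₀⟩ := hne
  have hx : ∀ j, 0 ≤ (a j : ℤ) * d ∧
      ∀ i, 0 ≤ (Pi.single j 1 : Fin n → ℤ) i + a j * E i + 2 * ((a j * d) / 2) := by
    intro j
    have := H (Pi.single j 1) 0 (a j) le_rfl
      (fun i => by by_cases h : i = j <;> simp [h]) (by simp [Pi.single_apply])
    simpa using this.2
  have hd : 0 ≤ d := by
    have := (hx i₀).1
    have h0 : (0 : ℤ) < a i₀ := by exact_mod_cast Nat.pos_of_ne_zero hi₀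
    exact nonneg_of_mul_nonneg_right this h0
  -- Were all `E_i + d` nonnegative, `S` would contain `2 (E, d)`, where `v` is `-2`.
  obtain ⟨i, hi⟩ : ∃ i, E i + d < 0 := by
    by_contra! hall
    have := (H (fun i => 2 * E i) (2 * d) (-2) (by omega) (fun i => by have := hall i; omega) (by
      have : ∑ i, (a i : ℤ) * (2 * E i) = 2 * ∑ i, (a i : ℤ) * E i := by
        rw [Finset.mul_sum]; exact Finset.sum_congr rfl fun i _ => by ring
      rw [this]; linarith)).1
    omega
  -- On the facet `m_i + k = 0` of the cone of `S` the function `v` vanishes.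
  have hface : ∀ (m : Fin n → ℤ) (k v : ℤ), 0 ≤ k → (∀ i, 0 ≤ m i + 2 * (k / 2)) →
      v = ∑ i, (a i : ℤ) * m i + b * k → v ≤ m i + k := by
    intro m k v hk hm hv
    obtain ⟨h1, h2, h3⟩ := H m k v hk hm hv
    have h4 := h3 i
    have h5 : 2 * ((k + v * d) / 2) ≤ k + v * d := by omega
    nlinarith
  have haj : ∀ j ≠ i, a j = 0 := by
    intro j hj
    have := hface (Pi.single j 1) 0 (a j) le_rfl
      (fun i => by by_cases h : i = j <;> simp [h]) (by simp [Pi.single_apply])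
    rw [Pi.single_eq_of_ne hj.symm] at this
    omega
  have hai : a i ≠ 0 := by
    by_cases h : i₀ = i
    · exact h ▸ hi₀
    · exact absurd (haj i₀ h) hi₀
  have hai1 : a i = 1 := by
    have := hface (Pi.single i 1) 0 (a i) le_rfl
      (fun j => by by_cases h : j = i <;> simp [h]) (by simp [Pi.single_apply])
    rw [Pi.single_eq_same] at this
    omega
  have hsum : ∀ m : Fin n → ℤ, ∑ j, (a j : ℤ) * m j = m i := by
    intro m
    rw [Finset.sum_eq_single i (fun j _ hj => by rw [haj j hj]; simp) (by simp), hai1]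
    simp
  have hb : b = 1 := by
    have hy : ∀ v : ℤ, v = ∑ i, (a i : ℤ) * (-2) + b * 2 → 0 ≤ v ∧ v ≤ 0 := by
      intro v hv
      have h1 := (H (fun _ => -2) 2 v (by norm_num) (fun _ => by norm_num) hv).1
      have h2 := hface (fun _ => -2) 2 v (by norm_num) (fun _ => by norm_num) hv
      exact ⟨h1, by simpa using h2⟩
    have := hy _ rfl
    rw [hsum fun _ => -2] at this
    omega
  rw [hsum, hb] at hE
  have hEi : E i = -1 - d := by push_cast at hE; linarith
  -- Integrality: `x_i` forces `d` to be even, `z` forces it to be odd.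
  have h1 := (hx i).2 i
  have h2 := (H 0 1 1 (by norm_num) (fun _ => by norm_num) (by simp [hb])).2.2 i
  rw [Pi.single_eq_same, hai1, hEi] at h1
  rw [hEi] at h2
  simp at h1 h2
  omega

namespace QuadricRing

open LaurentExp

variable {n : ℕ} {β γ : ℂ}

theorem adjoin_coord : Algebra.adjoin ℂ (Set.range (coord n β γ)) = ⊤ := by
  rw [Algebra.adjoin_range_eq_range_aeval, AlgHom.range_eq_top]
  exact restrict_surjective

/-- The scalars of the leading part of a derivation on the coordinate functions come from an
additive function of the exponent; on `y` this follows from the defining equation, whose leading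
part is `x^{[2]} y + z^2`. -/
theorem leadingScalar_coord_y {D : Derivation ℂ (QuadricRing n β γ) (QuadricRing n β γ)}
    {e : LaurentExp n} {l : Coord n → ℂ}
    (hl : ∀ t, LeadingScalar (toLaurent n β γ) D e (coord n β γ t) (coordExp n t) (l t)) :
    l (Sum.inr 0) = 2 * l (Sum.inr 1) - 2 * ∑ i, l (Sum.inl i) := by
  have hX : LeadingScalar (toLaurent n β γ) D e (base n β γ (xMon n)) (mk 1 0)
      (∑ i, l (Sum.inl i)) := by
    have h1 := LeadingScalar.prod Finset.univ fun i _ => hl (Sum.inl i)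
    have h2 : (∑ i, coordExp n (Sum.inl i)) = mk 1 0 := by
      refine LaurentExp.ext ?_ fun i => ?_
      · rw [map_sum]; simp [coordExp]
      · rw [map_sum]; simp [coordExp, Pi.single_apply]
    have h3 : ∏ i, coord n β γ (Sum.inl i) = base n β γ (xMon n) := by
      simp only [coord_x, xMon, map_prod]
    rwa [h2, h3] at h1
  have hzz := (hl (Sum.inr 1)).mul (hl (Sum.inr 1))
  have hM : coordExp n (Sum.inr 1) + coordExp n (Sum.inr 1) = mk 0 2 :=
    LaurentExp.ext (by simp [coordExp]) (by simp [coordExp])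
  rw [hM] at hzz
  have hxy := (hX.pow 2).mul (hl (Sum.inr 0))
  have hM' : 2 • (mk 1 0 : LaurentExp n) + coordExp n (Sum.inr 0) = mk 0 2 := by
    refine LaurentExp.ext ?_ fun i => ?_
    · rw [map_add, map_nsmul]; simp [coordExp]
    · rw [map_add, map_nsmul]; simp [coordExp]
  rw [hM'] at hxy
  have hlt : ∀ a : Fin n → ℤ, mk 0 2 < mk a 0 := fun a => lt_of_zDeg_lt (by simp)
  have hγ : LeadingScalar (toLaurent n β γ) D e (algebraMap ℂ _ γ) (mk 0 2)
      (((2 : ℕ) : ℂ) * ∑ i, l (Sum.inl i) + l (Sum.inr 0)) :=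
    (LeadingScalar.algebraMap γ).of_lt (by rw [← mk_zero]; exact hlt 0) _
  have hβ : LeadingScalar (toLaurent n β γ) D e ((-β) • base n β γ (xMon n)) (mk 0 2)
      (((2 : ℕ) : ℂ) * ∑ i, l (Sum.inl i) + l (Sum.inr 0)) :=
    (hX.smul _).of_lt (hlt 1) _
  have hsum := (hγ.add hβ).add (hxy.smul (-1))
  have heq : algebraMap ℂ (QuadricRing n β γ) γ + (-β) • base n β γ (xMon n) +
      (-1 : ℂ) • (base n β γ (xMon n) ^ 2 * coord n β γ (Sum.inr 0)) =
      coord n β γ (Sum.inr 1) * coord n β γ (Sum.inr 1) := by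
    rw [coord_z_mul_self, smul_eq_base_mul, smul_eq_base_mul]
    have : base n β γ (C β) = algebraMap ℂ _ β := rfl
    rw [← this, map_neg C, map_neg C, map_neg, map_neg, map_one C, map_one]
    ring
  rw [heq] at hsum
  have hne := ((hasLeadingExp_coord (β := β) (γ := γ) (Sum.inr 1 : Coord n)).mul
    (hasLeadingExp_coord (β := β) (γ := γ) (Sum.inr 1))).2
  rw [hM, ← map_mul] at hne
  have := hzz.unique hsum hne
  push_cast at this
  linear_combination -this

/-- The additive function on exponents with prescribed values at `x_1, …, x_n` and `z`. -/
noncomputable def weight (l : Coord n → ℂ) : LaurentExp n →+ ℂ where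
  toFun m := ∑ i, (xDeg i m : ℂ) * l (Sum.inl i) + zDeg n m * l (Sum.inr 1)
  map_zero' := by simp
  map_add' a b := by
    simp only [map_add, Int.cast_add, add_mul, Finset.sum_add_distrib]; ring

theorem weight_apply (l : Coord n → ℂ) (m : LaurentExp n) :
    weight l m = ∑ i, (xDeg i m : ℂ) * l (Sum.inl i) + zDeg n m * l (Sum.inr 1) := rfl

theorem weight_coordExp {l : Coord n → ℂ}
    (hl : l (Sum.inr 0) = 2 * l (Sum.inr 1) - 2 * ∑ i, l (Sum.inl i)) (t : Coord n) :
    weight l (coordExp n t) = l t := by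
  rcases t with i | t
  · simp [weight_apply, coordExp, Pi.single_apply]
  · fin_cases t
    · simp only [weight_apply, coordExp, Fin.zero_eta, Sum.elim_inr, Matrix.cons_val_zero,
        xDeg_mk, zDeg_mk, hl, ← Finset.mul_sum]
      push_cast; ring
    · simp [weight_apply, coordExp]

/-- The leading part of a derivation acts on the leading term of every element through the additive
function `weight l`. -/
theorem leadingScalar_of_hasLeadingExp
    {D : Derivation ℂ (QuadricRing n β γ) (QuadricRing n β γ)} {e : LaurentExp n} {l : Coord n → ℂ}
    (hl : ∀ t, LeadingScalar (toLaurent n β γ) D e (coord n β γ t) (coordExp n t) (l t))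
    {f : QuadricRing n β γ} {m : LaurentExp n} (h : (toLaurent n β γ f).HasLeadingExp m) :
    LeadingScalar (toLaurent n β γ) D e f m (weight l m) := by
  have hw := weight_coordExp (leadingScalar_coord_y hl)
  have hmon : ∀ u, LeadingScalar (toLaurent n β γ) D e (basisMonomial n β γ u) (monomialExp u)
      (weight l (monomialExp u)) := by
    intro u
    have := ((LeadingScalar.prod Finset.univ fun i _ => (hl (Sum.inl i)).pow (u.1 i)).mul
      ((hl (Sum.inr 0)).pow u.2.1)).mul ((hl (Sum.inr 1)).pow u.2.2)
    convert! this using 1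
    simp only [monomialExp, map_add, map_sum, map_nsmul, hw]
    simp only [nsmul_eq_mul]
  have hf : f ≠ 0 := by rintro rfl; exact h.2 (by simp)
  obtain ⟨c, rfl, u₀, hu₀, hmin⟩ := exists_expansion hf
  obtain rfl := h.unique (hasLeadingExp_of_expansion hu₀ hmin)
  refine LeadingScalar.sum _ fun u hu => ?_
  rcases (hmin u hu).eq_or_lt with he | hlt
  · rw [monomialExp_injective he]; exact (hmon u).smul _
  · exact ((hmon u).smul _).of_lt hlt _

theorem hasLeadingExp_deriv
    {D : Derivation ℂ (QuadricRing n β γ) (QuadricRing n β γ)} {e : LaurentExp n} {l : Coord n → ℂ}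
    (hl : ∀ t, LeadingScalar (toLaurent n β γ) D e (coord n β γ t) (coordExp n t) (l t))
    {f : QuadricRing n β γ} {m : LaurentExp n} (h : (toLaurent n β γ f).HasLeadingExp m)
    (hm : weight l m ≠ 0) : (toLaurent n β γ (D f)).HasLeadingExp (m + e) := by
  have hL := leadingScalar_of_hasLeadingExp hl h
  exact ⟨hL.2, by rw [hL.3]; exact mul_ne_zero hm h.2⟩

/-- If a power of `D` kills `f`, the leading exponent of `f` travels along `e`, within the
exponents of the ring, until its weight vanishes. -/
theorem exists_weight_add_nsmul_eq_zero
    {D : Derivation ℂ (QuadricRing n β γ) (QuadricRing n β γ)} {e : LaurentExp n} {l : Coord n → ℂ}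
    (hl : ∀ t, LeadingScalar (toLaurent n β γ) D e (coord n β γ t) (coordExp n t) (l t)) (N : ℕ) :
    ∀ {f : QuadricRing n β γ} {m : LaurentExp n}, (toLaurent n β γ f).HasLeadingExp m →
      D^[N] f = 0 → ∃ (j : ℕ) (u : MonomialIdx n), weight l m + j * weight l e = 0 ∧
        m + j • e = monomialExp u := by
  induction N with
  | zero =>
    intro f m h hf
    rw [Function.iterate_zero, id] at hf
    exact absurd (by simp [hf]) h.2
  | succ N ih =>
    intro f m h hf
    by_cases hm : weight l m = 0
    · have hf0 : f ≠ 0 := by rintro rfl; exact h.2 (by simp)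
      obtain ⟨u, hu⟩ := exists_hasLeadingExp hf0
      exact ⟨0, u, by simp [hm], by simpa using h.unique hu⟩
    · obtain ⟨j, u, hj, hu⟩ := ih (hasLeadingExp_deriv hl h hm) hf
      refine ⟨j + 1, u, ?_, ?_⟩
      · rw [map_add] at hj; push_cast; linear_combination hj
      · rw [← hu, succ_nsmul]; abel

theorem exists_monomialExp_eq_mk {m : Fin n → ℤ} {k : ℤ} (hk : 0 ≤ k)
    (hm : ∀ i, 0 ≤ m i + 2 * (k / 2)) : ∃ u, monomialExp u = mk m k := by
  refine ⟨(fun i => (m i + 2 * (k / 2)).toNat, (k / 2).toNat, ⟨(k % 2).toNat, by omega⟩),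
    LaurentExp.ext ?_ fun i => ?_⟩
  · simp only [zDeg_monomialExp, zDeg_mk]; omega
  · have := hm i
    simp only [xDeg_monomialExp, xDeg_mk]; omega

/-- The leading part of a nonzero locally nilpotent derivation is, up to a scalar, the derivation
`x^a z^k ↦ k x^{a + E} z^{k - 1}`. -/
theorem exists_leadingScalar_zDeg
    {D : Derivation ℂ (QuadricRing n β γ) (QuadricRing n β γ)} (hD : D ≠ 0)
    (hnil : ∀ f, ∃ N : ℕ, D^[N] f = 0) :
    ∃ (e : LaurentExp n) (w : ℂ), w ≠ 0 ∧ zDeg n e = -1 ∧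
      ∀ f m, (toLaurent n β γ f).HasLeadingExp m →
        LeadingScalar (toLaurent n β γ) D e f m (zDeg n m * w) := by
  have hgen : ∃ t, D (coord n β γ t) ≠ 0 := by
    by_contra! h
    refine hD (Derivation.ext_of_adjoin_eq_top _ adjoin_coord ?_)
    rintro _ ⟨t, rfl⟩
    simpa using h t
  obtain ⟨e, l, hl, t₀, ht₀⟩ := LeadingScalar.exists_of_ne_zero toLaurent_injective
    (fun t => (hasLeadingExp_coord (β := β) (γ := γ) t).1) (fun t => (hasLeadingExp_coord t).2) hgen
  have hw := weight_coordExp (leadingScalar_coord_y hl)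
  have hmove : ∀ {f : QuadricRing n β γ} {m : LaurentExp n}, (toLaurent n β γ f).HasLeadingExp m →
      ∃ (j : ℕ) (u : MonomialIdx n), weight l m + j * weight l e = 0 ∧
        m + j • e = monomialExp u := fun {f} {m} h =>
    (hnil f).elim fun N hN => exists_weight_add_nsmul_eq_zero hl N h hN
  have he : weight l e ≠ 0 := by
    intro h0
    obtain ⟨j, _, hj, _⟩ := hmove (hasLeadingExp_coord t₀)
    rw [h0, hw] at hj
    exact ht₀ (by simpa using hj)
  have hcoord : ∀ t, ∃ j : ℕ, l t = -(j * weight l e) := by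
    intro t
    obtain ⟨j, _, hj, _⟩ := hmove (hasLeadingExp_coord t)
    rw [hw] at hj
    exact ⟨j, by linear_combination hj⟩
  choose a ha using hcoord
  have hweight : ∀ m, weight l m = -(((∑ i, (a (Sum.inl i) : ℤ) * xDeg i m +
      a (Sum.inr 1) * zDeg n m : ℤ) : ℂ) * weight l e) := by
    intro m
    rw [weight_apply l m, ha (Sum.inr 1)]
    push_cast
    rw [add_mul, Finset.sum_mul, neg_add, ← Finset.sum_neg_distrib]
    congr 1
    · refine Finset.sum_congr rfl fun i _ => ?_
      rw [ha]; ring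
    · ring
  have hE : ∑ i, (a (Sum.inl i) : ℤ) * xDeg i e + a (Sum.inr 1) * zDeg n e = -1 := by
    have h1 := hweight e
    generalize (∑ i, (a (Sum.inl i) : ℤ) * xDeg i e + a (Sum.inr 1) * zDeg n e) = s at h1
    have h2 : ((s : ℂ) + 1) * weight l e = 0 := by linear_combination h1
    have h3 := (mul_eq_zero.1 h2).resolve_right he
    have h4 : ((s + 1 : ℤ) : ℂ) = 0 := by push_cast; exact h3
    have := Int.cast_eq_zero.1 h4
    omega
  have hzero : ∀ i, a (Sum.inl i) = 0 := by
    refine forall_weight_eq_zero (fun i => xDeg i e) (zDeg n e) (fun i => a (Sum.inl i))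
      (a (Sum.inr 1)) hE fun m k v hk hm hv => ?_
    obtain ⟨u, hu⟩ := exists_monomialExp_eq_mk hk hm
    obtain ⟨j, u', hj, hu'⟩ := hmove (hu ▸ hasLeadingExp_basisMonomial (β := β) (γ := γ) u)
    rw [hweight] at hj
    simp only [xDeg_mk, zDeg_mk] at hj
    rw [← hv] at hj
    have hvj : v = j := by
      have h2 : ((j : ℂ) - v) * weight l e = 0 := by linear_combination hj
      have h3 := (mul_eq_zero.1 h2).resolve_right he
      have h4 : ((j - v : ℤ) : ℂ) = 0 := by push_cast; exact h3
      have := Int.cast_eq_zero.1 h4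
      omega
    have hz := congrArg (zDeg n) hu'
    rw [map_add, map_nsmul, zDeg_mk, zDeg_monomialExp, nsmul_eq_mul, ← hvj] at hz
    refine ⟨by omega, by omega, fun i => ?_⟩
    have hx := congrArg (xDeg i) hu'
    rw [map_add, map_nsmul, xDeg_mk, xDeg_monomialExp, nsmul_eq_mul, ← hvj] at hx
    rw [hx, hz]
    omega
  simp only [hzero, Nat.cast_zero, zero_mul, Finset.sum_const_zero, zero_add] at hE hweight
  have hb : (a (Sum.inr 1) : ℤ) = 1 := by
    have hu : IsUnit (a (Sum.inr 1) : ℤ) := IsUnit.of_mul_eq_one (-zDeg n e) (by linarith)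
    rcases Int.isUnit_iff.1 hu with h | h <;> omega
  rw [hb] at hE hweight
  refine ⟨e, -weight l e, neg_ne_zero.2 he, by omega, fun f m h => ?_⟩
  have := leadingScalar_of_hasLeadingExp hl h
  rw [hweight] at this
  convert! this using 1
  push_cast; ring

/-- The kernel of a nonzero locally nilpotent derivation lies in `A = ℂ[x_1, …, x_n]`, and the
kernel of its square in `A + A z`. -/
theorem mem_of_deriv_eq_zero
    {D : Derivation ℂ (QuadricRing n β γ) (QuadricRing n β γ)} (hD : D ≠ 0)
    (hnil : ∀ f, ∃ N : ℕ, D^[N] f = 0) {f : QuadricRing n β γ} (hf : D (D f) = 0) :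
    ∃ a b, f = base n β γ a * coord n β γ (Sum.inr 1) + base n β γ b ∧ (D f = 0 → a = 0) := by
  obtain ⟨e, w, hw, he, hlead⟩ := exists_leadingScalar_zDeg hD hnil
  by_cases hf0 : f = 0
  · exact ⟨0, 0, by simp [hf0], fun _ => rfl⟩
  obtain ⟨u, hu⟩ := exists_hasLeadingExp hf0
  have hker : ∀ {g m}, (toLaurent n β γ g).HasLeadingExp m → D g = 0 → zDeg n m = 0 := by
    intro g m h hg
    have := (hlead g m h).3
    rw [hg, map_zero, HahnSeries.coeff_zero] at this
    simpa [hw, h.2] using this.symm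
  by_cases hz : zDeg n (monomialExp u) = 0
  · obtain ⟨a, b, hab, ha⟩ := exists_base_of_zDeg_le_one hu (by omega)
    exact ⟨a, b, hab, fun _ => ha hz.le⟩
  · have hne : (zDeg n (monomialExp u) : ℂ) * w ≠ 0 := mul_ne_zero (Int.cast_ne_zero.2 hz) hw
    have hL := hlead f _ hu
    have h2 : (toLaurent n β γ (D f)).HasLeadingExp (monomialExp u + e) :=
      ⟨hL.2, by rw [hL.3]; exact mul_ne_zero hne hu.2⟩
    have h3 := hker h2 hf
    rw [map_add, he] at h3
    obtain ⟨a, b, hab, -⟩ := exists_base_of_zDeg_le_one hu (by omega)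
    exact ⟨a, b, hab, fun h => absurd (hker hu h) hz⟩

end QuadricRing

/-! ### The standard locally nilpotent derivation -/

namespace QuadricRing

variable {n : ℕ} {β γ β' γ' : ℂ}

theorem derivative_zSq :
    Polynomial.derivative (zSq n β γ) = -Polynomial.C (xMon n ^ 2) := by
  rw [zSq, Polynomial.derivative_sub, Polynomial.derivative_C, Polynomial.derivative_C_mul,
    Polynomial.derivative_X, mul_one, zero_sub]

/-- The derivation `x^{[2]} ∂/∂z - 2 z ∂/∂y`. -/
noncomputable def stdDeriv (n : ℕ) (β γ : ℂ) :
    Derivation ℂ (QuadricRing n β γ) (QuadricRing n β γ) :=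
  Derivation.mk'
    { toFun r := ⟨-2 * Polynomial.derivative r.im * zSq n β γ + Polynomial.C (xMon n ^ 2) * r.im,
        -2 * Polynomial.derivative r.re⟩
      map_add' a b := by
        ext1
        · simp only [QuadraticAlgebra.re_add, QuadraticAlgebra.im_add, map_add]; ring
        · simp only [QuadraticAlgebra.re_add, QuadraticAlgebra.im_add, map_add]; ring
      map_smul' c a := by
        ext1
        · simp only [QuadraticAlgebra.re_smul, QuadraticAlgebra.im_smul, RingHom.id_apply,
            Polynomial.derivative_smul, mul_smul_comm, smul_mul_assoc, smul_add]
        · simp only [QuadraticAlgebra.re_smul, QuadraticAlgebra.im_smul, RingHom.id_apply,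
            Polynomial.derivative_smul, mul_smul_comm] }
    (fun a b => by
      ext1
      · simp only [LinearMap.coe_mk, AddHom.coe_mk, smul_eq_mul, QuadraticAlgebra.re_add, re_mul,
          im_mul, Polynomial.derivative_add, Polynomial.derivative_mul]
        ring
      · simp only [LinearMap.coe_mk, AddHom.coe_mk, smul_eq_mul, QuadraticAlgebra.im_add, re_mul,
          im_mul, Polynomial.derivative_add, Polynomial.derivative_mul, derivative_zSq]
        ring)

theorem stdDeriv_apply (r : QuadricRing n β γ) : stdDeriv n β γ r =
    ⟨-2 * Polynomial.derivative r.im * zSq n β γ + Polynomial.C (xMon n ^ 2) * r.im,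
      -2 * Polynomial.derivative r.re⟩ := rfl

theorem stdDeriv_base (a : MvPolynomial (Fin n) ℂ) : stdDeriv n β γ (base n β γ a) = 0 := by
  rw [stdDeriv_apply]; ext1 <;> simp

theorem stdDeriv_z :
    stdDeriv n β γ (coord n β γ (Sum.inr 1)) = base n β γ (xMon n ^ 2) := by
  rw [stdDeriv_apply, coord_z]
  ext1
  · rw [base_re]; simp
  · rw [base_im]; simp

theorem xMon_ne_zero : xMon n ≠ 0 := Finset.prod_ne_zero_iff.2 fun i _ => X_ne_zero i

theorem stdDeriv_ne_zero : stdDeriv n β γ ≠ 0 := by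
  intro h
  have h1 := stdDeriv_z (n := n) (β := β) (γ := γ)
  rw [h, Derivation.zero_apply, ← map_zero (base n β γ)] at h1
  exact pow_ne_zero 2 xMon_ne_zero (base_injective h1).symm

theorem degree_derivative_lt {R : Type*} [Semiring R] {p : Polynomial R} {k : ℕ}
    (h : p.degree < (k + 1 : ℕ)) : (Polynomial.derivative p).degree < k := by
  rw [Polynomial.degree_lt_iff_coeff_zero] at h ⊢
  intro m hm
  rw [Polynomial.coeff_derivative, h (m + 1) (by omega), zero_mul]

theorem stdDeriv_nilpotent (f : QuadricRing n β γ) :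
    ∃ N : ℕ, (stdDeriv n β γ)^[N] f = 0 := by
  -- Applying the derivation twice lowers the degree in `y` of both components.
  have key : ∀ (k : ℕ) (f : QuadricRing n β γ), f.re.degree < k → f.im.degree < k →
      (stdDeriv n β γ)^[2 * k] f = 0 := by
    intro k
    induction k with
    | zero =>
      intro f h1 h2
      rw [Polynomial.degree_lt_iff_coeff_zero] at h1 h2
      have e1 : f.re = 0 := Polynomial.ext fun m => h1 m (Nat.zero_le m)
      have e2 : f.im = 0 := Polynomial.ext fun m => h2 m (Nat.zero_le m)
      simpa using QuadraticAlgebra.ext e1 e2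
    | succ k ih =>
      intro f h1 h2
      have hmul : ∀ {p : Polynomial (MvPolynomial (Fin n) ℂ)} {m : ℕ} (q),
          p.degree < (m : WithBot ℕ) →
          (Polynomial.C q * p).degree < (m : WithBot ℕ) := by
        intro p m q hp
        rw [Polynomial.degree_lt_iff_coeff_zero] at hp ⊢
        intro j hj
        rw [Polynomial.coeff_C_mul, hp j hj, mul_zero]
      have hstep : ∀ {p q : Polynomial (MvPolynomial (Fin n) ℂ)} {m : ℕ},
          p.degree < (m : WithBot ℕ) →
          q.degree < ((m + 1 : ℕ) : WithBot ℕ) → (-2 * p * zSq n β γ +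
            Polynomial.C (xMon n ^ 2) * q).degree < ((m + 1 : ℕ) : WithBot ℕ) := by
        intro p q m hp hq
        have e : -2 * p * zSq n β γ = Polynomial.C (-2 * (C γ - C β * xMon n)) * p +
            Polynomial.C (2 * xMon n ^ 2) * (p * Polynomial.X) := by
          rw [zSq]; simp only [map_mul, map_neg, map_ofNat]; ring
        have hpX : (p * Polynomial.X).degree < ((m + 1 : ℕ) : WithBot ℕ) := by
          rw [Polynomial.degree_lt_iff_coeff_zero] at hp ⊢
          intro j hj
          obtain ⟨j, rfl⟩ : ∃ i, j = i + 1 := ⟨j - 1, by omega⟩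
          rw [Polynomial.coeff_mul_X, hp j (by omega)]
        have hp' : p.degree < ((m + 1 : ℕ) : WithBot ℕ) :=
          hp.trans (by exact_mod_cast Nat.lt_succ_self m)
        rw [e]
        refine (Polynomial.degree_add_le _ _).trans_lt (max_lt ?_ (hmul _ hq))
        exact (Polynomial.degree_add_le _ _).trans_lt (max_lt (hmul _ hp') (hmul _ hpX))
      have hneg : ∀ {p : Polynomial (MvPolynomial (Fin n) ℂ)} {m : ℕ},
          p.degree < (m : WithBot ℕ) →
          (-2 * p).degree < (m : WithBot ℕ) := by
        intro p m hp
        have : (-2 * p) = Polynomial.C (-2) * p := by rw [map_neg, map_ofNat]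
        rw [this]; exact hmul _ hp
      have hd1 := hneg (degree_derivative_lt h1)
      have hd2 := hstep (degree_derivative_lt h2) h2
      rw [Nat.mul_succ, Function.iterate_add_apply]
      refine ih _ ?_ ?_
      · simp only [Function.iterate_succ, Function.iterate_zero, Function.comp_apply, id,
          stdDeriv_apply]
        cases k with
        | zero =>
          have h0 : Polynomial.derivative f.re = 0 := by
            have := degree_derivative_lt h1
            rw [Polynomial.degree_lt_iff_coeff_zero] at this
            exact Polynomial.ext fun m => this m (Nat.zero_le m)
          simp [h0]
        | succ k => exact hstep (degree_derivative_lt hd1) hd1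
      · simp only [Function.iterate_succ, Function.iterate_zero, Function.comp_apply, id,
          stdDeriv_apply]
        exact hneg (degree_derivative_lt hd2)
  refine ⟨_, key (max (f.re.natDegree + 1) (f.im.natDegree + 1)) f ?_ ?_⟩
  · refine (Polynomial.degree_le_natDegree).trans_lt ?_
    exact_mod_cast (Nat.lt_succ_self _).trans_le (le_max_left _ _)
  · refine (Polynomial.degree_le_natDegree).trans_lt ?_
    exact_mod_cast (Nat.lt_succ_self _).trans_le (le_max_right _ _)

/-! ### Isomorphisms between the coordinate rings -/

/-- The derivation of the target of an isomorphism that corresponds to `stdDeriv`. -/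
noncomputable def transportDeriv (φ : QuadricRing n β γ ≃ₐ[ℂ] QuadricRing n β' γ') :
    Derivation ℂ (QuadricRing n β' γ') (QuadricRing n β' γ') :=
  Derivation.mk'
    (φ.toLinearMap ∘ₗ (stdDeriv n β γ : QuadricRing n β γ →ₗ[ℂ] QuadricRing n β γ) ∘ₗ
      φ.symm.toLinearMap)
    (fun a b => by simp)

theorem transportDeriv_apply (φ : QuadricRing n β γ ≃ₐ[ℂ] QuadricRing n β' γ')
    (f : QuadricRing n β γ) : transportDeriv φ (φ f) = φ (stdDeriv n β γ f) := by
  change φ (stdDeriv n β γ (φ.symm (φ f))) = _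
  rw [AlgEquiv.symm_apply_apply]

theorem transportDeriv_ne_zero (φ : QuadricRing n β γ ≃ₐ[ℂ] QuadricRing n β' γ') :
    transportDeriv φ ≠ 0 := by
  intro h
  refine stdDeriv_ne_zero (n := n) (β := β) (γ := γ) (Derivation.ext fun f => φ.injective ?_)
  rw [← transportDeriv_apply, h]; simp

theorem transportDeriv_nilpotent (φ : QuadricRing n β γ ≃ₐ[ℂ] QuadricRing n β' γ')
    (g : QuadricRing n β' γ') : ∃ N : ℕ, (transportDeriv φ)^[N] g = 0 := by
  obtain ⟨f, rfl⟩ := φ.surjective g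
  obtain ⟨N, hN⟩ := stdDeriv_nilpotent f
  refine ⟨N, ?_⟩
  have : Function.Semiconj φ (stdDeriv n β γ) (transportDeriv φ) :=
    fun f => (transportDeriv_apply φ f).symm
  rw [← (this.iterate_right N).eq, hN, map_zero]

/-- Isomorphisms preserve the subring `A = ℂ[x_1, …, x_n]`. -/
theorem exists_algEquiv_base (φ : QuadricRing n β γ ≃ₐ[ℂ] QuadricRing n β' γ')
    (a : MvPolynomial (Fin n) ℂ) : ∃ a', φ (base n β γ a) = base n β' γ' a' := by
  have h0 : transportDeriv φ (φ (base n β γ a)) = 0 := by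
    rw [transportDeriv_apply, stdDeriv_base, map_zero]
  obtain ⟨c, b, hb, hc⟩ := mem_of_deriv_eq_zero (transportDeriv_ne_zero φ)
    (transportDeriv_nilpotent φ) (f := φ (base n β γ a)) (by rw [h0, map_zero])
  exact ⟨b, by rw [hb, hc h0, map_zero, zero_mul, zero_add]⟩

/-- Isomorphisms preserve `A + A z`. -/
theorem exists_algEquiv_coord_z (φ : QuadricRing n β γ ≃ₐ[ℂ] QuadricRing n β' γ') :
    ∃ a b, φ (coord n β γ (Sum.inr 1)) =
      base n β' γ' a * coord n β' γ' (Sum.inr 1) + base n β' γ' b := by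
  obtain ⟨a, b, hab, -⟩ := mem_of_deriv_eq_zero (transportDeriv_ne_zero φ)
    (transportDeriv_nilpotent φ) (f := φ (coord n β γ (Sum.inr 1))) (by
      rw [transportDeriv_apply, stdDeriv_z, transportDeriv_apply, stdDeriv_base, map_zero])
  exact ⟨a, b, hab⟩

/-- An isomorphism maps `z` to `a z + b` with a nonzero constant `a`. -/
theorem exists_algEquiv_coord_z_const (φ : QuadricRing n β γ ≃ₐ[ℂ] QuadricRing n β' γ') :
    ∃ (a : ℂ) (b : MvPolynomial (Fin n) ℂ), a ≠ 0 ∧ φ (coord n β γ (Sum.inr 1)) =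
      base n β' γ' (C a) * coord n β' γ' (Sum.inr 1) + base n β' γ' b := by
  obtain ⟨a, b, hab⟩ := exists_algEquiv_coord_z φ
  obtain ⟨a', b', hab'⟩ := exists_algEquiv_coord_z φ.symm
  obtain ⟨c, hc⟩ := exists_algEquiv_base φ a'
  obtain ⟨d, hd⟩ := exists_algEquiv_base φ b'
  have h := congrArg φ hab'
  rw [AlgEquiv.apply_symm_apply, map_add, map_mul, hab, hc, hd] at h
  have him := congrArg QuadraticAlgebra.im h
  simp only [QuadraticAlgebra.im_add, QuadraticAlgebra.re_add, im_mul, re_mul, base_re, base_im,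
    coord_z] at him
  have hunit : IsUnit a := by
    refine IsUnit.of_mul_eq_one c (Polynomial.C_injective ?_)
    rw [Polynomial.C_mul, Polynomial.C_1]
    linear_combination -him
  obtain ⟨r, hr, rfl⟩ := isUnit_iff_eq_C_of_isReduced.1 hunit
  exact ⟨r, b, hr.ne_zero, hab⟩

/-- Comparison of the defining equations under an isomorphism, where `u` is the image of
`x^{[1]}`. -/
theorem exists_relation (φ : QuadricRing n β γ ≃ₐ[ℂ] QuadricRing n β' γ') :
    ∃ (u : MvPolynomial (Fin n) ℂ) (a : ℂ), a ≠ 0 ∧ φ (base n β γ (xMon n)) = base n β' γ' u ∧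
      u ^ 2 ∣ xMon n ^ 2 ∧
      u ^ 2 ∣ C (a ^ 2) * (C γ' - C β' * xMon n) - (C γ - C β * u) := by
  obtain ⟨u, hu⟩ := exists_algEquiv_base φ (xMon n)
  obtain ⟨a, b, ha, hab⟩ := exists_algEquiv_coord_z_const φ
  have h := congrArg φ (coord_z_mul_self (n := n) (β := β) (γ := γ))
  have hc : ∀ c, algebraMap ℂ (QuadricRing n β' γ') c = base n β' γ' (C c) := fun _ => rfl
  rw [map_sub, map_sub, map_mul, map_mul, map_mul, map_pow, hab, hu, AlgEquiv.commutes,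
    AlgEquiv.commutes, hc, hc, ← map_mul, ← map_sub, ← map_pow] at h
  generalize φ (coord n β γ (Sum.inr 0)) = Y at h
  have hre := congrArg QuadraticAlgebra.re h
  have him := congrArg QuadraticAlgebra.im h
  simp only [QuadraticAlgebra.im_add, QuadraticAlgebra.re_add, QuadraticAlgebra.im_sub,
    QuadraticAlgebra.re_sub, im_mul, re_mul, base_re, base_im, coord_z, mul_zero, zero_mul,
    add_zero, zero_add, mul_one, zero_sub] at hre him
  have hre0 := congrArg (fun p => Polynomial.coeff p 0) hre
  have hre1 := congrArg (fun p => Polynomial.coeff p 1) hre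
  have him0 := congrArg (fun p => Polynomial.coeff p 0) him
  simp only [zSq, Polynomial.coeff_add, Polynomial.coeff_sub, Polynomial.coeff_neg,
    Polynomial.mul_coeff_zero, Polynomial.coeff_C_zero, Polynomial.coeff_X_zero, mul_zero,
    sub_zero] at hre0 him0
  have hre1' : C a ^ 2 * xMon n ^ 2 = u ^ 2 * Y.re.coeff 1 := by
    have e : zSq n β' γ' * Polynomial.C (C a) * Polynomial.C (C a) =
        Polynomial.C (C a ^ 2 * (C γ' - C β' * xMon n)) -
          Polynomial.C (C a ^ 2 * xMon n ^ 2) * Polynomial.X := by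
      rw [zSq]; simp only [map_sub, map_mul, map_pow]; ring
    rw [e, ← Polynomial.C_mul] at hre1
    simp only [Polynomial.coeff_add, Polynomial.coeff_sub, Polynomial.coeff_C_mul,
      Polynomial.coeff_X_one, Polynomial.coeff_C_succ, mul_one, zero_sub, zero_add] at hre1
    linear_combination -hre1
  have hinv : C a⁻¹ * C a = (1 : MvPolynomial (Fin n) ℂ) := by
    rw [← C_mul, inv_mul_cancel₀ ha, C_1]
  have hb : u ^ 2 ∣ b := by
    refine ⟨-C (2⁻¹) * C a⁻¹ * Y.im.coeff 0, ?_⟩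
    have h2 : C (2⁻¹ : ℂ) * 2 = (1 : MvPolynomial (Fin n) ℂ) := by
      rw [← map_ofNat (C : ℂ →+* MvPolynomial (Fin n) ℂ) 2, ← C_mul,
        inv_mul_cancel₀ two_ne_zero, C_1]
    linear_combination (-b) * hinv - C a⁻¹ * C a * b * h2 + C (2⁻¹) * C a⁻¹ * him0
  refine ⟨u, a, ha, hu, ⟨C a⁻¹ ^ 2 * Y.re.coeff 1, ?_⟩, ?_⟩
  · linear_combination C a⁻¹ ^ 2 * hre1' - (C a⁻¹ * C a + 1) * xMon n ^ 2 * hinv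
  · obtain ⟨d, hd⟩ := hb
    refine ⟨-Y.re.coeff 0 - b * d, ?_⟩
    rw [C_pow]
    linear_combination hre0 - b * hd

/-- The coordinate rings remember which of the two parameters vanish. -/
theorem eq_zero_iff_of_algEquiv (hn : 1 ≤ n) (φ : QuadricRing n β γ ≃ₐ[ℂ] QuadricRing n β' γ') :
    (β = 0 ↔ β' = 0) ∧ (γ = 0 ↔ γ' = 0) := by
  obtain ⟨u, a, ha, hu, hdvd, hrel⟩ := exists_relation φ
  obtain ⟨v, -, -, hv, ⟨c, hc⟩, -⟩ := exists_relation φ.symm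
  obtain ⟨c', hc'⟩ := exists_algEquiv_base φ c
  have hx := xMon_ne_zero (n := n)
  have hdvd' : xMon n ^ 2 ∣ u ^ 2 := by
    refine ⟨c', base_injective (β := β') (γ := γ') ?_⟩
    have h := congrArg (fun p => φ (base n β γ p)) hc
    simp only [map_mul, map_pow] at h
    rw [hu, ← hv, AlgEquiv.apply_symm_apply, hc'] at h
    rw [map_pow, h, map_mul, map_pow]
  -- Hence `u` is a nonzero constant times `x^{[1]}`.
  obtain ⟨μ, hμ, rfl⟩ : ∃ μ : ℂ, μ ≠ 0 ∧ u = C μ * xMon n := by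
    obtain ⟨w, hw⟩ := associated_of_dvd_dvd hdvd' hdvd
    obtain ⟨r, hr, hr'⟩ := isUnit_iff_eq_C_of_isReduced.1 w.isUnit
    obtain ⟨μ, hμ⟩ := IsAlgClosed.exists_pow_nat_eq r (n := 2) (by norm_num)
    have hμ0 : μ ≠ 0 := by rintro rfl; exact hr.ne_zero (by simpa using hμ.symm)
    have hsq : (u - C μ * xMon n) * (u - C (-μ) * xMon n) = 0 := by
      rw [hr', ← hμ, C_pow] at hw
      rw [map_neg]
      linear_combination -hw
    rcases mul_eq_zero.1 hsq with h | h
    · exact ⟨μ, hμ0, sub_eq_zero.1 h⟩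
    · exact ⟨-μ, neg_ne_zero.2 hμ0, sub_eq_zero.1 h⟩
  -- The relation becomes `x^{[2]} ∣ (a² γ' - γ) + (β μ - a² β') x^{[1]}`.
  have hrel' : xMon n ^ 2 ∣ C (a ^ 2 * γ' - γ) + C (β * μ - a ^ 2 * β') * xMon n := by
    refine hdvd'.trans (hrel.trans (dvd_of_eq ?_))
    simp only [C_sub, C_mul]
    ring
  have heval : ∀ κ : ℂ, xMon n ∣ C κ → κ = 0 := by
    rintro κ ⟨d, hd⟩
    have h := congrArg (eval 0) hd
    have h0 : eval 0 (xMon n) = 0 := by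
      rw [xMon, map_prod]
      exact Finset.prod_eq_zero (Finset.mem_univ (⟨0, hn⟩ : Fin n)) (by simp)
    rw [map_mul, h0, zero_mul, eval_C] at h
    exact h
  have hγ : a ^ 2 * γ' - γ = 0 := by
    refine heval _ ?_
    have h1 := (dvd_pow_self (xMon n) two_ne_zero).trans hrel'
    exact (dvd_add_left (Dvd.intro_left _ rfl)).1 h1
  have hβ : β * μ - a ^ 2 * β' = 0 := by
    refine heval _ ?_
    rw [hγ, C_0, zero_add, pow_two] at hrel'
    exact (mul_dvd_mul_iff_right hx).1 hrel'
  have ha2 := pow_ne_zero 2 ha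
  constructor
  · constructor
    · rintro rfl; simpa [ha2] using hβ
    · rintro rfl; simpa [hμ] using hβ
  · constructor
    · rintro rfl; simpa [ha2] using hγ
    · rintro rfl; simpa using hγ

end QuadricRing

/-! ### The classification -/

theorem quadricHypersurface_eq_zero_iff {n : ℕ} (hn : 1 ≤ n) {β γ β' γ' : ℂ}
    (h : IsomorphicVarieties (quadricHypersurface n β γ) (quadricHypersurface n β' γ')) :
    (β = 0 ↔ β' = 0) ∧ (γ = 0 ↔ γ' = 0) :=
  (QuadricRing.nonempty_algEquiv_of_isomorphic h).elim (QuadricRing.eq_zero_iff_of_algEquiv hn)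

theorem fibre_isomorphic_model_iff {n : ℕ} (hn : 1 ≤ n) (q : Polynomial ℂ) (c : ℂ) (i j : Fin 2) :
    IsomorphicVarieties (fibre n q c) (modelHypersurface n i j) ↔
      (i = 0 ↔ q.eval c = 0) ∧ (j = 0 ↔ c = 0) := by
  have hcast : ∀ k : Fin 2, ((k : ℕ) : ℂ) = 0 ↔ k = 0 := by
    intro k; rw [Nat.cast_eq_zero]; exact Fin.val_eq_zero_iff
  have h₀ := fibre_isomorphic_quadricHypersurface n q c
  constructor
  · intro h
    have h1 := quadricHypersurface_eq_zero_iff hn (h₀.symm.trans h)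
    rw [hcast, hcast] at h1
    exact ⟨h1.1.symm, h1.2.symm⟩
  · rintro ⟨hi, hj⟩
    exact h₀.trans (quadricHypersurface_isomorphic_model hn hi hj)

theorem mainTheorem2 (n : ℕ) (hn : 1 ≤ n) :
    (∀ (q : Polynomial ℂ) (c : ℂ),
      (IsomorphicVarieties (fibre n q c) (modelHypersurface n 0 0) ↔ c = 0 ∧ q.eval c = 0) ∧
      (IsomorphicVarieties (fibre n q c) (modelHypersurface n 1 0) ↔ c = 0 ∧ q.eval c ≠ 0) ∧
      (IsomorphicVarieties (fibre n q c) (modelHypersurface n 0 1) ↔ c ≠ 0 ∧ q.eval c = 0) ∧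
      (IsomorphicVarieties (fibre n q c) (modelHypersurface n 1 1) ↔ c ≠ 0 ∧ q.eval c ≠ 0) ∧
      ∃! ij : Fin 2 × Fin 2,
        IsomorphicVarieties (fibre n q c) (modelHypersurface n ij.1 ij.2)) ∧
    (∀ i j i' j' : Fin 2, (i, j) ≠ (i', j') →
      ¬ IsomorphicVarieties (modelHypersurface n i j) (modelHypersurface n i' j')) := by
  refine ⟨fun q c => ?_, fun i j i' j' hne h => hne ?_⟩
  · have hcrit := fibre_isomorphic_model_iff hn q c
    refine ⟨?_, ?_, ?_, ?_, ?_⟩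
    · rw [hcrit]; simp [and_comm]
    · rw [hcrit]; simp [and_comm]
    · rw [hcrit]; simp [and_comm]
    · rw [hcrit]; simp [and_comm]
    · classical
      refine ⟨(if q.eval c = 0 then 0 else 1, if c = 0 then 0 else 1), ?_, ?_⟩
      · change IsomorphicVarieties _ _
        rw [hcrit]
        constructor <;> split_ifs <;> simp_all
      · rintro ⟨i, j⟩ h
        change IsomorphicVarieties _ _ at h
        rw [hcrit] at h
        refine Prod.ext ?_ ?_
        · by_cases h0 : q.eval c = 0
          · simpa [h0] using h.1
          · simpa [h0] using Fin.eq_one_of_ne_zero i (mt h.1.1 h0)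
        · by_cases h0 : c = 0
          · simpa [h0] using h.2
          · simpa [h0] using Fin.eq_one_of_ne_zero j (mt h.2.1 h0)
  · rw [modelHypersurface_eq, modelHypersurface_eq] at h
    obtain ⟨h1, h2⟩ := quadricHypersurface_eq_zero_iff hn h
    simp only [Nat.cast_eq_zero, Fin.val_eq_zero_iff] at h1 h2
    have e : ∀ {k l : Fin 2}, (k = 0 ↔ l = 0) → k = l := by decide
    rw [e h1, e h2]
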